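/- Let $d\in\mathbb C^\times$, and let $\mathcal O_d$ be the strict $\mathbb C$-linear tensor category of oriented Kauffman diagrams: its objects are the words $X^w$, $w\in\mathbb N*\mathbb N$, in two letters $X,X^*$ (the empty word is the unit object $I$); $\mathrm{Hom}(X^w,X^{w'})$ is the complex vector space with basis the oriented Kauffman diagrams (isotopy classes of disjoint oriented planar strings in a rectangle) with upper word $w$ and lower word $w'$; composition is concatenation of diagrams, each closed loop, of either orientation, being replaced by the factor $d$; and the tensor product is horizontal juxtaposition. Assume that we are in the semisimple case, i.e. that the alternating algebras $\mathrm{End}(X\otimes X^*\otimes X\otimes\cdots)$ ($n$ factors) are semisimple for all $n$. In the idempotent completion $\overline{\mathcal O}_d$ let $X_n$ and $Y_n$ ($n\ge 1$) be the subobjects of the alternating products $X\otimes X^*\otimes\cdots$ and $X^*\otimes X\otimes\cdots$ ($n$ factors) that are the images of the $n$-th Jones–Wenzl idempotents. For a word $w=w_1\cdots w_l$, factorized into its maximal alternating subwords, let $X_w\subset X^w$ be the tensor product of the objects $X_n$ or $Y_n$ attached to $w_1,\dots,w_l$, that is, the image of the tensor product $P_w$ of the corresponding Jones–Wenzl idempotents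 (so $P_w^2=P_w$, and $X_\emptyset=I$). Then, for all $w,w'\in\mathbb N*\mathbb N$, $$\mathrm{Hom}(X_w,X_{w'})=\{0\}\quad\text{if } w\ne w',\qquad \mathrm{Hom}(X_w,X_w)=\mathbb C\,1_{X_w},$$ and $1_{X_w}\ne 0$. -/

import Mathlib

/-!
Oriented Kauffman diagrams and the tensor category they form.

Letters are booleans: `true` is the letter X and `false` is its dual X*.  A word is a
`List Bool`, that is, an element of the free product monoid `ℕ * ℕ` (free on two generators).

A planar diagram is encoded by its boundary: the end points are numbered `0, 1, 2, ...` along the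
boundary of the rectangle, cut open at one place, and `p : ℕ → ℕ` sends an end point to the
other end of its string.  Numbers that are not end points are fixed by `p`.
-/

namespace OrientedKauffman

/-! ### Operations on pairings of points on a line -/

/-- Renumbering of the points when `l` new points are inserted before point `t`. -/
def shift (t l y : ℕ) : ℕ := if y < t then y else y + l

/-- Insert the pairing `q`, on `l` points, in front of the point `t` of the pairing `p`. -/
def ins (t l : ℕ) (q p : ℕ → ℕ) (x : ℕ) : ℕ :=
  if x < t then shift t l (p x)
  else if x < t + l then t + q (x - t)
  else shift t l (p (x - l))

/-- Renumbering when the points `i`, `i + 1` are deleted: from new numbers to old ones. -/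
def skip (i x : ℕ) : ℕ := if x < i then x else x + 2
/-- Renumbering when the points `i`, `i + 1` are deleted: from old numbers to new ones. -/
def unskip (i y : ℕ) : ℕ := if y < i then y else y - 2
/-- The other end of the string from `x` after the end points `i` and `i'` have been glued. -/
def join (i i' : ℕ) (p : ℕ → ℕ) (x : ℕ) : ℕ :=
  if p x = i then p i' else if p x = i' then p i else p x

/-- Glue the neighbouring end points `i` and `i + 1` of `p`, so that the two strings ending there
become one string (or a closed loop, which is deleted), and renumber the other points. -/
def contract (i : ℕ) (p : ℕ → ℕ) (x : ℕ) : ℕ := unskip i (join i (i + 1) p (skip i x))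

/-- Glue point `a + k - 1 - j` with point `a + k + j` for `j = 0, ..., k - 1`, innermost pair
first. -/
def glue (a : ℕ) : ℕ → (ℕ → ℕ) → (ℕ → ℕ)
  | 0, p => p
  | k + 1, p => glue a k (contract (a + k) p)

/-- Gluing `i` and `i + 1` closes a loop exactly if they are the two ends of one string. -/
def loopAt (i : ℕ) (p : ℕ → ℕ) : ℕ := if p i = i + 1 then 1 else 0

/-- The number of closed loops that arise in `glue a k p`. -/
def loops (a : ℕ) : ℕ → (ℕ → ℕ) → ℕ
  | 0, _ => 0
  | k + 1, p => loopAt (a + k) p + loops a k (contract (a + k) p)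

/-- `p` is a noncrossing perfect matching of the positions of the word `v` that pairs opposite
letters.  (By `orient` no position of `v` is paired with itself.) -/
structure IsPlanar (v : List Bool) (p : ℕ → ℕ) : Prop where
  invol : ∀ x, p (p x) = x
  outside : ∀ x, v.length ≤ x → p x = x
  orient : ∀ x, v[p x]? = v[x]?.map not
  noncross : ∀ x y, x < y → y < p x → p y < p x

/-! ### Elementary facts about these operations -/

theorem skip_inj {i x y : ℕ} (h : skip i x = skip i y) : x = y := by
  simp only [skip] at h; split_ifs at h <;> omega
theorem skip_ne (i x : ℕ) : skip i x ≠ i ∧ skip i x ≠ i + 1 := by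
  simp only [skip]; split_ifs <;> omega
theorem skip_unskip {i y : ℕ} (h : y ≠ i) (h' : y ≠ i + 1) : skip i (unskip i y) = y := by
  simp only [skip, unskip]; split_ifs <;> omega
theorem skip_skip {i j : ℕ} (hij : i ≤ j) (x : ℕ) : skip i (skip j x) = skip (j + 2) (skip i x) := by
  simp only [skip]; split_ifs <;> omega
theorem skip_lt {i x y : ℕ} : skip i x < skip i y ↔ x < y := by
  simp only [skip]; split_ifs <;> omega
theorem skip_lo {i j : ℕ} (h : j < i) : skip i j = j := by simp [skip, h]
theorem skip_hi {i j : ℕ} (h : i ≤ j) : skip i j = j + 2 := by simp [skip, h]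

section Join
variable {i i' k k' x : ℕ} {p : ℕ → ℕ}

theorem join_ne (hp : ∀ x, p (p x) = x) (h : p i ≠ i) (h' : p i' ≠ i')
    (hx : x ≠ i) (hx' : x ≠ i') : join i i' p x ≠ i ∧ join i i' p x ≠ i' := by
  have := hp i
  have := hp i'
  have := hp x
  simp only [join]
  grind

theorem join_invol (hp : ∀ x, p (p x) = x) 
    (hx : x ≠ i) (hx' : x ≠ i') : join i i' p (join i i' p x) = x := by
  have := hp i
  have := hp i'
  have := hp x
  simp only [join]
  grind

theorem join_comm (hp : ∀ x, p (p x) = x) (h0 : i ≠ i') (h0' : k ≠ k') (h1 : i ≠ k) (h2 : i ≠ k') (h3 : i' ≠ k) (h4 : i' ≠ k')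
    (hx : x ≠ i ∧ x ≠ i') (hx' : x ≠ k ∧ x ≠ k') :
    join k k' (join i i' p) x = join i i' (join k k' p) x := by
  have := hp i
  have := hp i'
  have := hp k
  have := hp k'
  have := hp x
  simp only [join]
  grind (splits := 30)

theorem join_loops (hp : ∀ x, p (p x) = x) (h0 : i ≠ i') (h0' : k ≠ k') (h1 : i ≠ k) (h2 : i ≠ k') (h3 : i' ≠ k) (h4 : i' ≠ k') :
    (if p i = i' then 1 else 0) + (if join i i' p k = k' then 1 else 0) =
    (if p k = k' then 1 else 0) + (if join k k' p i = i' then 1 else 0) := by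
  have := hp i
  have := hp i'
  have := hp k
  have := hp k'
  simp only [join]
  grind (splits := 30)

end Join

theorem skip_contract {i : ℕ} {p : ℕ → ℕ} (hp : ∀ x, p (p x) = x) (h : p i ≠ i)
    (h' : p (i + 1) ≠ i + 1) (x : ℕ) :
    skip i (contract i p x) = join i (i + 1) p (skip i x) := by
  obtain ⟨h1, h2⟩ := join_ne hp h h' (skip_ne i x).1 (skip_ne i x).2
  exact skip_unskip h1 h2

theorem contract_invol {i : ℕ} {p : ℕ → ℕ} (hp : ∀ x, p (p x) = x) (h : p i ≠ i)
    (h' : p (i + 1) ≠ i + 1) (x : ℕ) : contract i p (contract i p x) = x := by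
  apply skip_inj (i := i)
  rw [skip_contract hp h h', skip_contract hp h h']
  exact join_invol hp (skip_ne i x).1 (skip_ne i x).2

theorem contract_ne {i : ℕ} {p : ℕ → ℕ} (hp : ∀ x, p (p x) = x) (h : p i ≠ i)
    (h' : p (i + 1) ≠ i + 1) (x : ℕ) (hx : p (skip i x) ≠ skip i x) : contract i p x ≠ x := by
  intro e
  have := skip_contract hp h h' x
  rw [e] at this
  have a1 := skip_ne i x
  have := hp i
  have := hp (i + 1)
  have := hp (skip i x)
  simp only [join] at *
  grind

theorem contract_comm {i j : ℕ} (hij : i ≤ j) {p : ℕ → ℕ} (hp : ∀ x, p (p x) = x)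
    (h : ∀ x, x < j + 4 → p x ≠ x) :
    contract j (contract i p) = contract i (contract (j + 2) p) := by
  have hi := h i (by omega)
  have hi' := h (i+1) (by omega)
  have hj := h (j+2) (by omega)
  have hj' := h (j+3) (by omega)
  have c1 := fun x => contract_invol hp hi hi' x
  have c2 := fun x => contract_invol hp hj hj' x
  have d1 := contract_ne hp hi hi' j (by rwa [skip_hi hij])
  have d2 := contract_ne hp hi hi' (j+1) (by rwa [skip_hi (by omega)])
  have d3 := contract_ne hp hj hj' i (by rwa [skip_lo (by omega)])
  have d4 := contract_ne hp hj hj' (i+1) (by rwa [skip_lo (by omega)])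
  funext x
  apply skip_inj (i := j); apply skip_inj (i := i)
  rw [skip_contract c1 d1 d2]
  conv_rhs => rw [skip_skip hij, skip_contract c2 d3 d4]
  obtain ⟨y, hy⟩ : ∃ y, y = skip i (skip j x) := ⟨_, rfl⟩
  have y1 := skip_ne i (skip j x)
  have y2 := skip_ne (j+2) (skip i x)
  rw [← skip_skip hij] at y2
  rw [← hy] at y1 y2
  have key : ∀ (m : ℕ) (q : ℕ → ℕ) (a b z : ℕ), skip m a = b →
      (q z = a ↔ skip m (q z) = b) := by
    intro m q a b z e
    exact ⟨fun h => by rw [h, e], fun h => skip_inj (h.trans e.symm)⟩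
  have L : skip i (join j (j + 1) (contract i p) (skip j x))
      = join (j+2) (j+3) (join i (i + 1) p) y := by
    conv_lhs => unfold join
    conv_rhs => unfold join
    simp only [key i (contract i p) j (j+2) _ (skip_hi hij),
      key i (contract i p) (j+1) (j+3) _ (skip_hi (by omega)),
      apply_ite (skip i), skip_contract hp hi hi', ← hy]
    rw [skip_hi hij, skip_hi (show i ≤ j + 1 by omega)]
    rfl
  have R : skip (j+2) (join i (i + 1) (contract (j+2) p) (skip i x))
      = join i (i + 1) (join (j+2) (j+3) p) y := by
    conv_lhs => unfold join
    conv_rhs => unfold join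
    simp only [key (j+2) (contract (j+2) p) i i _ (skip_lo (by omega)),
      key (j+2) (contract (j+2) p) (i+1) (i+1) _ (skip_lo (by omega)),
      apply_ite (skip (j+2)), skip_contract hp hj hj', ← skip_skip hij, ← hy]
    rw [skip_lo (show i < j+2 by omega), skip_lo (show i + 1 < j + 2 by omega)]
    rfl
  rw [L, R]
  exact join_comm hp (by omega) (by omega) (by omega) (by omega) (by omega) (by omega) y1 y2

theorem loops_comm {i j : ℕ} (hij : i ≤ j) {p : ℕ → ℕ} (hp : ∀ x, p (p x) = x)
    (h : ∀ x, x < j + 4 → p x ≠ x) :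
    loopAt i p + loopAt j (contract i p) = loopAt (j + 2) p + loopAt i (contract (j + 2) p) := by
  have hi := h i (by omega)
  have hi' := h (i+1) (by omega)
  have hj := h (j+2) (by omega)
  have hj' := h (j+3) (by omega)
  have e1 : contract i p j = j + 1 ↔ join i (i+1) p (j + 2) = j + 3 := by
    rw [← skip_hi hij, ← skip_contract hp hi hi', show j + 3 = skip i (j + 1) by rw [skip_hi]; omega]
    exact ⟨fun h => by rw [h], skip_inj⟩
  have e2 : contract (j+2) p i = i + 1 ↔ join (j+2) (j+3) p i = i + 1 := by
    have : join (j+2) (j+3) p i = skip (j+2) (contract (j+2) p i) := by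
      rw [skip_contract hp hj hj', skip_lo (by omega)]
    rw [this]
    constructor
    · intro h; rw [h, skip_lo (by omega)]
    · intro h; exact skip_inj (by rw [h, skip_lo (by omega)])
  simp only [loopAt, e1, e2]
  exact join_loops hp (by omega) (by omega) (by omega) (by omega) (by omega) (by omega)

theorem IsPlanar.ne {v : List Bool} {p : ℕ → ℕ} (hp : IsPlanar v p) {x : ℕ} (hx : x < v.length) :
    p x ≠ x := by
  intro h
  have := hp.orient x
  rw [h, List.getElem?_eq_getElem hx] at this
  simp at this

theorem IsPlanar.lt {v : List Bool} {p : ℕ → ℕ} (hp : IsPlanar v p) {x : ℕ} (hx : x < v.length) :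
    p x < v.length := by
  by_contra h
  have h1 := hp.outside _ (not_lt.1 h)
  rw [hp.invol] at h1
  omega

theorem ins_shift {t l : ℕ} (q p : ℕ → ℕ) (y : ℕ) :
    ins t l q p (shift t l y) = shift t l (p y) := by
  by_cases h : y < t
  · simp [ins, shift, h]
  · simp [ins, shift, h, show ¬ y + l < t by omega]

theorem ins_mid {t l : ℕ} (q p : ℕ → ℕ) {y : ℕ} (hy : y < l) :
    ins t l q p (t + y) = t + q y := by
  simp [ins, hy]

theorem shift_or (t l x : ℕ) : (∃ y, x = shift t l y) ∨ ∃ y, y < l ∧ x = t + y := by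
  by_cases h : x < t
  · exact Or.inl ⟨x, by simp [shift, h]⟩
  by_cases h' : x < t + l
  · exact Or.inr ⟨x - t, by omega, by omega⟩
  · exact Or.inl ⟨x - l, by rw [shift, if_neg] <;> omega⟩

theorem shift_lt {t l x y : ℕ} : shift t l x < shift t l y ↔ x < y := by
  simp only [shift]; split_ifs <;> omega

theorem planar_ins {u v z : List Bool} {p q : ℕ → ℕ} (hp : IsPlanar (u ++ v) p)
    (hq : IsPlanar z q) : IsPlanar (u ++ (z ++ v)) (ins u.length z.length q p) := by
  have q5 := fun x (hx : x < z.length) => hq.lt hx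
  obtain ⟨p1, p2, p3, p4⟩ := hp
  obtain ⟨q1, q2, q3, q4⟩ := hq
  have s1 : ∀ y, (u ++ (z ++ v))[shift u.length z.length y]? = (u ++ v)[y]? := by
    intro y
    simp only [shift]
    split_ifs with h
    · simp [List.getElem?_append, h]
    · rw [List.getElem?_append_right (by omega), List.getElem?_append_right (by omega),
        List.getElem?_append_right (by omega)]
      congr 1
      omega
  have s2 : ∀ y, y < z.length → (u ++ (z ++ v))[u.length + y]? = z[y]? := by
    intro y h
    simp [List.getElem?_append, h]
  refine ⟨fun x => ?_, fun x hx => ?_, fun x => ?_, fun x y hx hy => ?_⟩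
  · obtain ⟨y, rfl⟩ | ⟨y, hy, rfl⟩ := shift_or u.length z.length x
    · rw [ins_shift, ins_shift, p1]
    · rw [ins_mid _ _ hy, ins_mid _ _ (q5 _ hy), q1]
  · simp only [List.length_append] at hx p2
    have := p2 (x - z.length) (by omega)
    simp only [ins, this, shift]
    split_ifs <;> omega
  · obtain ⟨y, rfl⟩ | ⟨y, hy, rfl⟩ := shift_or u.length z.length x
    · rw [ins_shift, s1, s1, p3]
    · rw [ins_mid _ _ hy, s2 _ (q5 _ hy), s2 _ hy, q3]
  · obtain ⟨x, rfl⟩ | ⟨x, hx', rfl⟩ := shift_or u.length z.length x <;>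
    obtain ⟨y, rfl⟩ | ⟨y, hy', rfl⟩ := shift_or u.length z.length y
    · simp only [ins_shift, shift_lt] at *
      exact p4 x y hx hy
    · rw [ins_shift] at *
      rw [ins_mid _ _ hy']
      have := q5 y hy'
      simp only [shift] at *
      split_ifs at * <;> omega
    · rw [ins_mid _ _ hx'] at *
      have := q5 x hx'
      simp only [shift] at *
      split_ifs at * <;> omega
    · rw [ins_mid _ _ hx'] at *
      rw [ins_mid _ _ hy']
      have := q4 x y
      omega

theorem planar_contract {u v : List Bool} {a b : Bool} {p : ℕ → ℕ}
    (hab : b = !a) (hp : IsPlanar (u ++ a :: b :: v) p) :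
    IsPlanar (u ++ v) (contract u.length p) := by
  have n0 := fun x (hx : x < _) => hp.ne (x := x) hx
  have len : (u ++ a :: b :: v).length = (u ++ v).length + 2 := by simp; omega
  rw [len] at n0
  have hl : u.length ≤ (u ++ v).length := by simp
  obtain ⟨p1, p2, p3, p4⟩ := hp
  rw [len] at p2
  have l1 : (u ++ a :: b :: v)[u.length]? = some a := by simp
  have l2 : (u ++ a :: b :: v)[u.length+1]? = some b := by simp
  have l3 : ∀ x, (u ++ v)[x]? = (u ++ a :: b :: v)[skip u.length x]? := by
    intro x
    simp only [skip, List.getElem?_append]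
    split_ifs with h h2
    · rfl
    · omega
    · rw [show x + 2 - u.length = x - u.length + 1 + 1 by omega]; simp
  generalize (u ++ a :: b :: v) = W at *
  generalize (u ++ v) = W' at *
  generalize u.length = i at *
  have hi := n0 i (by omega)
  have hi' := n0 (i+1) (by omega)
  have sk := skip_contract p1 hi hi'
  have e1 := p1 i
  have e2 := p1 (i+1)
  refine ⟨contract_invol p1 hi hi', fun x hx => ?_, fun x => ?_, fun x y hx hy => ?_⟩
  · apply skip_inj (i := i)
    rw [sk, skip_hi (by omega)]
    have := p2 (x + 2) (by omega)
    simp only [join, this]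
    split_ifs <;> omega
  · rw [l3, l3, sk]
    have o1 := p3 i
    have o2 := p3 (i+1)
    have o3 := p3 (skip i x)
    simp only [join]
    split_ifs with h h'
    · grind
    · grind
    · exact o3
  · rw [← skip_lt (i := i)] at *
    rw [sk] at *
    rw [sk]
    have a1 := skip_ne i x
    have a2 := skip_ne i y
    generalize skip i x = X at *
    generalize skip i y = Y at *
    have nc : ∀ x y, x < y → y < p x → x < p y ∧ p y < p x := by
      intro x y h1 h2
      have h3 := p4 x y h1 h2
      refine ⟨?_, h3⟩
      by_contra h4
      have h5 := p1 y
      have h6 := p4 (p y) x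
      have h7 := p1 x
      by_cases h8 : p y = x
      · rw [h8] at h5; omega
      · rw [h5] at h6; omega
    have b1 := p1 X
    have b2 := p1 Y
    have c1 := nc X Y
    have c2 := nc Y X
    have c3 := nc X i
    have c4 := nc X (i + 1)
    have c5 := nc Y i
    have c6 := nc Y (i + 1)
    have c7 := nc Y (p i)
    have c8 := nc Y (p (i + 1))
    clear nc p1 p2 p3 p4 n0 sk l3
    simp only [join] at *
    split_ifs at * with h1 h2 h3 h4 h5 h6
    all_goals simp only [*] at *
    all_goals try omega
    all_goals grind


/-- `p` is a perfect matching of the first `n` natural numbers. -/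
structure Good (n : ℕ) (p : ℕ → ℕ) : Prop where
  invol : ∀ x, p (p x) = x
  ne : ∀ x, x < n → p x ≠ x
  out : ∀ x, n ≤ x → p x = x

theorem IsPlanar.good {v : List Bool} {p : ℕ → ℕ} (hp : IsPlanar v p) : Good v.length p :=
  ⟨hp.invol, fun _ => hp.ne, hp.outside⟩

theorem Good.lt {n : ℕ} {p : ℕ → ℕ} (hp : Good n p) {x : ℕ} (hx : x < n) : p x < n := by
  by_contra h
  have h1 := hp.out _ (not_lt.1 h)
  rw [hp.invol] at h1
  omega

theorem Good.skip {n i : ℕ} {p : ℕ → ℕ} (hp : Good (n + 2) p) (hi : i ≤ n) (x : ℕ) :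
    skip i (contract i p x) = join i (i + 1) p (skip i x) :=
  skip_contract hp.invol (hp.ne _ (by omega)) (hp.ne _ (by omega)) x

theorem Good.contract {n i : ℕ} {p : ℕ → ℕ} (hp : Good (n + 2) p) (hi : i ≤ n) :
    Good n (contract i p) := by
  have h1 := hp.ne i (by omega)
  have h2 := hp.ne (i + 1) (by omega)
  refine ⟨contract_invol hp.invol h1 h2, fun x hx => ?_, fun x hx => ?_⟩
  · refine contract_ne hp.invol h1 h2 x (hp.ne _ ?_)
    simp only [OrientedKauffman.skip]; split_ifs <;> omega
  · apply skip_inj (i := i)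
    rw [hp.skip hi, skip_hi (by omega)]
    have := hp.out (x + 2) (by omega)
    simp only [join, this]
    split_ifs <;> omega

theorem Good.glue {n a k : ℕ} {p : ℕ → ℕ} (hp : Good (n + 2 * k) p) (hi : a ≤ n) :
    Good n (glue a k p) := by
  induction k generalizing p with
  | zero => exact hp
  | succ k ih => exact ih (Good.contract hp (by omega))

theorem Good.ins {n t l : ℕ} {p q : ℕ → ℕ} (hp : Good n p) (hq : Good l q) (ht : t ≤ n) :
    Good (n + l) (ins t l q p) := by
  refine ⟨fun x => ?_, fun x hx => ?_, fun x hx => ?_⟩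
  · obtain ⟨y, rfl⟩ | ⟨y, hy, rfl⟩ := shift_or t l x
    · rw [ins_shift, ins_shift, hp.invol]
    · rw [ins_mid _ _ hy, ins_mid _ _ (hq.lt hy), hq.invol]
  · obtain ⟨y, rfl⟩ | ⟨y, hy, rfl⟩ := shift_or t l x
    · rw [ins_shift]
      have := hp.ne y (by simp only [shift] at hx; split_ifs at hx <;> omega)
      simp only [shift]; split_ifs <;> omega
    · rw [ins_mid _ _ hy]
      have := hq.ne y hy
      omega
  · have := hp.out (x - l) (by omega)
    simp only [OrientedKauffman.ins, this, shift]
    split_ifs <;> omega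

theorem contract_ins_left {n t l i : ℕ} {p q : ℕ → ℕ} (hp : Good (n + 2) p) (hq : Good l q)
    (ht : t ≤ n) (hi : i ≤ t) : contract i (ins (t + 2) l q p) = ins t l q (contract i p) := by
  have g := hp.ins hq (show t + 2 ≤ n + 2 by omega)
  rw [show n + 2 + l = n + l + 2 by omega] at g
  have e : ∀ z, OrientedKauffman.skip i (shift t l z) = shift (t + 2) l (OrientedKauffman.skip i z) := by
    intro z; simp only [shift, OrientedKauffman.skip]; split_ifs <;> omega
  have e' : ∀ z w, shift (t + 2) l z = shift (t + 2) l w ↔ z = w := by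
    intro z w; simp only [shift]; split_ifs <;> omega
  have f1 : i = shift (t + 2) l i := by simp only [shift]; split_ifs <;> omega
  have f2 : i + 1 = shift (t + 2) l (i + 1) := by simp only [shift]; split_ifs <;> omega
  funext x
  apply skip_inj (i := i)
  rw [g.skip (by omega)]
  obtain ⟨y, rfl⟩ | ⟨y, hy, rfl⟩ := shift_or t l x
  · rw [ins_shift, e, e, hp.skip (by omega)]
    have h1 : ins (t + 2) l q p i = shift (t + 2) l (p i) := by
      conv_lhs => rw [f1, ins_shift]
    have h2 : ins (t + 2) l q p (i + 1) = shift (t + 2) l (p (i + 1)) := by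
      conv_lhs => rw [f2, ins_shift]
    simp only [join, ins_shift, h1, h2, apply_ite (shift (t + 2) l)]
    have h3 : ∀ z, shift (t + 2) l z = i ↔ z = i := fun z => by
      conv_lhs => rhs; rw [f1]
      exact e' _ _
    have h4 : ∀ z, shift (t + 2) l z = i + 1 ↔ z = i + 1 := fun z => by
      conv_lhs => rhs; rw [f2]
      exact e' _ _
    simp only [h3, h4]
  · have := hq.lt hy
    rw [ins_mid _ _ hy, skip_hi (by omega), skip_hi (by omega),
      show t + y + 2 = t + 2 + y by omega]
    simp only [join]
    rw [ins_mid _ _ hy, if_neg (by omega), if_neg (by omega)]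
    omega

theorem contract_ins_mid {n t l i : ℕ} {p q : ℕ → ℕ} (hp : Good n p) (hq : Good (l + 2) q)
    (ht : t ≤ n) (hi : i ≤ l) :
    contract (t + i) (ins t (l + 2) q p) = ins t l (contract i q) p := by
  have g := hp.ins hq ht
  rw [← add_assoc] at g
  have e : ∀ z, OrientedKauffman.skip (t + i) (shift t l z) = shift t (l + 2) z := by
    intro z; simp only [shift, OrientedKauffman.skip]; split_ifs <;> omega
  have f : ∀ z, OrientedKauffman.skip (t + i) (t + z) = t + OrientedKauffman.skip i z := by
    intro z; simp only [OrientedKauffman.skip]; split_ifs <;> omega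
  have f2 : ∀ z, z < l → OrientedKauffman.skip i z < l + 2 := by
    intro z; simp only [OrientedKauffman.skip]; split_ifs <;> omega
  funext x
  apply skip_inj (i := t + i)
  rw [g.skip (by omega)]
  obtain ⟨y, rfl⟩ | ⟨y, hy, rfl⟩ := shift_or t l x
  · rw [ins_shift, e, e]
    simp only [join, ins_shift]
    rw [if_neg, if_neg] <;> simp only [shift] <;> split_ifs <;> omega
  · rw [ins_mid _ _ hy, f, f, hq.skip hi]
    simp only [join, ins_mid _ _ (f2 y hy), add_assoc,
      ins_mid _ _ (show i < l + 2 by omega), ins_mid _ _ (show i + 1 < l + 2 by omega)]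
    simp only [apply_ite (t + ·), Nat.add_left_cancel_iff]

theorem ins_ins {t s l m : ℕ} {p q r : ℕ → ℕ} (hs : s ≤ l) :
    ins (t + s) m r (ins t l q p) = ins t (l + m) (ins s m r q) p := by
  have e : ∀ z, shift t (l + m) z = shift (t + s) m (shift t l z) := by
    intro z; simp only [shift]; split_ifs <;> omega
  have f : ∀ z, t + shift s m z = shift (t + s) m (t + z) := by
    intro z; simp only [shift]; split_ifs <;> omega
  funext x
  obtain ⟨y, rfl⟩ | ⟨y, hy, rfl⟩ := shift_or t (l + m) x
  · rw [ins_shift, e, e, ins_shift, ins_shift]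
  · rw [ins_mid _ _ hy]
    obtain ⟨y, rfl⟩ | ⟨y, hy', rfl⟩ := shift_or s m y
    · have hy' : y < l := by simp only [shift] at hy; split_ifs at hy <;> omega
      rw [ins_shift, f, f, ins_shift, ins_mid _ _ hy']
    · rw [ins_mid _ _ hy', ← add_assoc, ← add_assoc, ins_mid _ _ hy']

theorem glue_ins_left {n t l a k : ℕ} {p q : ℕ → ℕ} (hp : Good (n + 2 * k) p) (hq : Good l q)
    (ht : t ≤ n) (ha : a ≤ t) :
    glue a k (ins (t + 2 * k) l q p) = ins t l q (glue a k p) ∧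
    loops a k (ins (t + 2 * k) l q p) = loops a k p := by
  induction k generalizing p with
  | zero => exact ⟨rfl, rfl⟩
  | succ k ih =>
    have h := contract_ins_left (i := a + k) (t := t + 2 * k) (n := n + 2 * k) hp hq
      (by omega) (by omega)
    obtain ⟨h1, h2⟩ := ih (hp.contract (by omega : a + k ≤ n + 2 * k))
    simp only [glue, loops]
    rw [show t + 2 * (k + 1) = t + 2 * k + 2 by omega, h, h1, h2]
    refine ⟨rfl, ?_⟩
    congr 1
    simp only [loopAt, ins, shift]
    split_ifs <;> omega

theorem glue_ins_mid {n t l s k : ℕ} {p q : ℕ → ℕ} (hp : Good n p) (hq : Good (l + 2 * k) q)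
    (ht : t ≤ n) (hs : s ≤ l) :
    glue (t + s) k (ins t (l + 2 * k) q p) = ins t l (glue s k q) p ∧
    loops (t + s) k (ins t (l + 2 * k) q p) = loops s k q := by
  induction k generalizing q with
  | zero => exact ⟨rfl, rfl⟩
  | succ k ih =>
    have h := contract_ins_mid (i := s + k) (l := l + 2 * k) (n := n) hp hq ht (by omega)
    obtain ⟨h1, h2⟩ := ih (hq.contract (by omega : s + k ≤ l + 2 * k))
    simp only [glue, loops]
    rw [show l + 2 * (k + 1) = l + 2 * k + 2 by omega, add_assoc t s k, h, h1, h2]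
    refine ⟨rfl, ?_⟩
    congr 1
    simp only [loopAt]
    rw [ins_mid _ _ (by omega)]
    split_ifs <;> omega

theorem contract_glue {n j a b : ℕ} {p : ℕ → ℕ} (hp : Good (n + 2 + 2 * b) p) (ha : a ≤ j)
    (hj : j ≤ n) :
    contract j (glue a b p) = glue a b (contract (j + 2 * b) p) ∧
    loops a b p + loopAt j (glue a b p) =
      loopAt (j + 2 * b) p + loops a b (contract (j + 2 * b) p) := by
  induction b generalizing p with
  | zero => simp [glue, loops]
  | succ b ih =>
    have hn : ∀ x, x < j + 2 * b + 4 → p x ≠ x := fun x hx => hp.ne x (by omega)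
    have h := contract_comm (i := a + b) (j := j + 2 * b) (by omega) hp.invol hn
    have h' := loops_comm (i := a + b) (j := j + 2 * b) (by omega) hp.invol hn
    obtain ⟨h1, h2⟩ := ih (hp.contract (by omega : a + b ≤ n + 2 + 2 * b))
    simp only [glue, loops]
    rw [show j + 2 * (b + 1) = j + 2 * b + 2 by omega]
    refine ⟨by rw [h1, h], ?_⟩
    rw [h] at h2
    omega

theorem glue_glue {n a b c : ℕ} {p : ℕ → ℕ} (hp : Good (n + 2 * c + 2 * b) p) (ha : a ≤ n) :
    glue a c (glue a b p) = glue a b (glue (a + 2 * b) c p) ∧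
    loops a b p + loops a c (glue a b p) =
      loops (a + 2 * b) c p + loops a b (glue (a + 2 * b) c p) := by
  induction c generalizing p with
  | zero => simp [glue, loops]
  | succ c ih =>
    obtain ⟨h1, h2⟩ := contract_glue (n := n + 2 * c) (j := a + c) (a := a) (b := b) hp
      (by omega) (by omega)
    rw [show n + 2 * (c + 1) + 2 * b = n + 2 * c + 2 * b + 2 by omega] at hp
    obtain ⟨h3, h4⟩ := ih (hp.contract (by omega : a + c + 2 * b ≤ n + 2 * c + 2 * b))
    simp only [glue, loops]
    rw [show a + 2 * b + c = a + c + 2 * b by omega, h1, h3]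
    refine ⟨rfl, ?_⟩
    rw [h3] at *
    omega

/-- Boundary pairing of `n` parallel vertical strings. -/
def idp (n x : ℕ) : ℕ := if x < 2 * n then 2 * n - 1 - x else x

theorem idp_good (n : ℕ) : Good (2 * n) (idp n) := by
  refine ⟨fun x => ?_, fun x hx => ?_, fun x hx => ?_⟩ <;> simp only [idp] <;> split_ifs <;> omega

theorem contract_id_right {n t j : ℕ} {p : ℕ → ℕ} (hp : Good n p) (ht : t + 1 ≤ n) :
    contract t (ins (t + 1) (2 * (j + 1)) (idp (j + 1)) p) = ins t (2 * j) (idp j) p := by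
  have g := hp.ins (idp_good (j + 1)) ht
  have hne := hp.ne t (by omega)
  set P := ins (t + 1) (2 * (j + 1)) (idp (j + 1)) p with hP
  have P0 : P t = shift (t + 1) (2 * (j + 1)) (p t) := by simp [hP, ins]
  have Pmid : ∀ z, z < 2 * (j + 1) → P (t + 1 + z) = t + 1 + (2 * (j + 1) - 1 - z) := by
    intro z hz
    rw [hP, ins_mid _ _ hz, idp, if_pos hz]
  have P1 : P (t + 1) = t + 1 + (2 * (j + 1) - 1) := Pmid 0 (by omega)
  have Pout : ∀ z, P (shift (t + 1) (2 * (j + 1)) z) = shift (t + 1) (2 * (j + 1)) (p z) := by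
    intro z; rw [hP, ins_shift]
  funext x
  apply skip_inj (i := t)
  rw [Good.skip (n := n + 2 * j) (by rw [show n + 2 * j + 2 = n + 2 * (j + 1) by omega]; exact g)
    (by omega)]
  obtain ⟨y, rfl⟩ | ⟨y, hy, rfl⟩ := shift_or t (2 * j) x
  · rw [ins_shift]
    by_cases h : y = t
    · subst h
      have e : OrientedKauffman.skip y (shift y (2 * j) y) = y + 1 + (2 * j + 1) := by
        simp only [OrientedKauffman.skip, shift]; split_ifs <;> omega
      have e2 : P (y + 1 + (2 * j + 1)) = y + 1 := by rw [Pmid _ (by omega)]; omega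
      rw [e, join, e2, if_neg (by omega), if_pos rfl, P0]
      simp only [OrientedKauffman.skip, shift]; split_ifs <;> omega
    · have e : OrientedKauffman.skip t (shift t (2 * j) y) = shift (t + 1) (2 * (j + 1)) y := by
        simp only [OrientedKauffman.skip, shift]; split_ifs <;> omega
      rw [e, join, Pout, P1, P0]
      simp only [OrientedKauffman.skip, shift]; split_ifs <;> omega
  · have e : OrientedKauffman.skip t (t + y) = t + 1 + (y + 1) := by
      simp only [OrientedKauffman.skip]; split_ifs <;> omega
    rw [ins_mid _ _ hy, e, join, Pmid _ (by omega), if_neg (by omega), if_neg (by omega)]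
    simp only [OrientedKauffman.skip, idp]; split_ifs <;> omega

theorem contract_id_left {n s j : ℕ} {p : ℕ → ℕ} (hp : Good n p) (ht : s + 1 ≤ n) :
    contract (s + 2 * j + 1) (ins s (2 * (j + 1)) (idp (j + 1)) p) =
      ins (s + 1) (2 * j) (idp j) p := by
  have g := hp.ins (idp_good (j + 1)) (show s ≤ n by omega)
  have hne := hp.ne s (by omega)
  set P := ins s (2 * (j + 1)) (idp (j + 1)) p with hP
  have Pmid : ∀ z, z < 2 * (j + 1) → P (s + z) = s + (2 * (j + 1) - 1 - z) := by
    intro z hz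
    rw [hP, ins_mid _ _ hz, idp, if_pos hz]
  have P0 : P (s + 2 * j + 1) = s := by rw [add_assoc, Pmid _ (by omega)]; omega
  have Pout : ∀ z, P (shift s (2 * (j + 1)) z) = shift s (2 * (j + 1)) (p z) := by
    intro z; rw [hP, ins_shift]
  have P1 : P (s + 2 * j + 1 + 1) = shift s (2 * (j + 1)) (p s) := by
    rw [← Pout]; congr 1; simp only [shift]; split_ifs <;> omega
  funext x
  apply skip_inj (i := s + 2 * j + 1)
  rw [Good.skip (n := n + 2 * j) (by rw [show n + 2 * j + 2 = n + 2 * (j + 1) by omega]; exact g)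
    (by omega)]
  obtain ⟨y, rfl⟩ | ⟨y, hy, rfl⟩ := shift_or (s + 1) (2 * j) x
  · rw [ins_shift]
    by_cases h : y = s
    · subst h
      have e : OrientedKauffman.skip (y + 2 * j + 1) (shift (y + 1) (2 * j) y) = y + 0 := by
        simp only [OrientedKauffman.skip, shift]; split_ifs <;> omega
      have e2 : P (y + 0) = y + 2 * j + 1 := by rw [Pmid _ (by omega)]; omega
      rw [e, join, e2, if_pos rfl, P1]
      simp only [OrientedKauffman.skip, shift]; split_ifs <;> omega
    · have e : OrientedKauffman.skip (s + 2 * j + 1) (shift (s + 1) (2 * j) y) = shift s (2 * (j + 1)) y := by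
        simp only [OrientedKauffman.skip, shift]; split_ifs <;> omega
      rw [e, join, Pout, P1, P0]
      simp only [OrientedKauffman.skip, shift]; split_ifs <;> omega
  · have e : OrientedKauffman.skip (s + 2 * j + 1) (s + 1 + y) = s + (y + 1) := by
      simp only [OrientedKauffman.skip]; split_ifs <;> omega
    rw [ins_mid _ _ hy, e, join, Pmid _ (by omega), if_neg (by omega), if_neg (by omega)]
    simp only [OrientedKauffman.skip, idp]; split_ifs <;> omega

theorem glue_id_right {n a j : ℕ} {p : ℕ → ℕ} (hp : Good n p) (ha : a + j ≤ n) :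
    glue a j (ins (a + j) (2 * j) (idp j) p) = p ∧
    loops a j (ins (a + j) (2 * j) (idp j) p) = 0 := by
  induction j with
  | zero =>
    refine ⟨?_, rfl⟩
    funext x
    simp only [glue, ins, shift]
    split_ifs <;> rfl
  | succ j ih =>
    obtain ⟨h1, h2⟩ := ih (by omega)
    have g := hp.ins (idp_good (j + 1)) ha
    have h : contract (a + j) (ins (a + (j + 1)) (2 * (j + 1)) (idp (j + 1)) p) =
        ins (a + j) (2 * j) (idp j) p :=
      contract_id_right hp (by omega)
    simp only [glue, loops]
    rw [h, h1, h2]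
    refine ⟨rfl, ?_⟩
    have := hp.ne (a + j) (by omega)
    simp only [loopAt, ins, idp, shift]
    split_ifs <;> omega

theorem glue_id_left {n a s j : ℕ} {p : ℕ → ℕ} (hp : Good n p) (ha : s + j = a) (hn : a ≤ n) :
    glue a j (ins s (2 * j) (idp j) p) = p ∧
    loops a j (ins s (2 * j) (idp j) p) = 0 := by
  induction j generalizing s with
  | zero =>
    refine ⟨?_, rfl⟩
    funext x
    simp only [glue, ins, shift]
    split_ifs <;> first | rfl | omega
  | succ j ih =>
    obtain ⟨h1, h2⟩ := ih (s := s + 1) (by omega)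
    have g := hp.ins (idp_good (j + 1)) (show s ≤ n by omega)
    have h : contract (a + j) (ins s (2 * (j + 1)) (idp (j + 1)) p) =
        ins (s + 1) (2 * j) (idp j) p := by
      rw [← contract_id_left hp (by omega)]
      congr 1
      omega
    simp only [glue, loops]
    rw [h, h1, h2]
    refine ⟨rfl, ?_⟩
    simp only [loopAt, ins, idp, shift]
    split_ifs <;> omega


theorem planar_glue {u m v : List Bool} {p : ℕ → ℕ}
    (hp : IsPlanar (u ++ (m ++ ((m.map not).reverse ++ v))) p) :
    IsPlanar (u ++ v) (glue u.length m.length p) := by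
  induction m using List.reverseRecOn generalizing p with
  | nil => simpa [glue] using hp
  | append_singleton m a ih =>
    rw [List.length_append, List.length_singleton, glue]
    apply ih
    have h := planar_contract (u := u ++ m) (a := a) (b := !a) (v := (m.map not).reverse ++ v)
      (p := p) rfl (by simpa using hp)
    simpa using h

theorem planar_id (w : List Bool) : IsPlanar ((w.map not).reverse ++ w) (idp w.length) := by
  have g := idp_good w.length
  refine ⟨g.invol, fun x hx => g.out x (by simp at hx; omega), fun x => ?_, fun x y h1 h2 => ?_⟩
  · simp only [idp, List.getElem?_append, List.length_reverse, List.length_map]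
    split_ifs with h h1 h2 h2
    · omega
    · rw [List.getElem?_reverse (by simpa using h1), List.getElem?_map, List.length_map]
      congr 2
      omega
    · rw [List.getElem?_reverse (by simpa using h2), List.getElem?_map, List.length_map,
        Option.map_map]
      simp only [Bool.involutive_not.comp_self, Option.map_id_fun, _root_.id]
      congr 1
      omega
    · omega
    · omega
    · rw [List.getElem?_eq_none (by omega)]
      rfl
  · simp only [idp] at *
    split_ifs at * <;> omega

/-! ### Oriented Kauffman diagrams -/

/-- The letters met by going around the rectangle: the upper word from right to left, then the
lower word from left to right.  Upper letters are dualized, so that a letter tells whether the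
string starts or ends there in the same way on the whole boundary; hence a string joins opposite
letters of `bdry w w'`.  Thus a string from top to bottom joins equal letters of the two words,
and a string with both ends on the same side joins an X with an X*. -/
def bdry (w w' : List Bool) : List Bool := (w.map not).reverse ++ w'

/-- The set of oriented Kauffman diagrams of type `(w, w')`, with `w` on the upper and `w'` on the
lower line: isotopy classes of disjoint planar strings in a rectangle, i.e. noncrossing perfect
matchings of the boundary points, compatible with the orientations. -/
@[ext]
structure Diagram (w w' : List Bool) where
  partner : ℕ → ℕ
  planar : IsPlanar (bdry w w') partner

namespace Diagram

/-- Vertical strings. -/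
def id (w : List Bool) : Diagram w w := ⟨idp w.length, planar_id w⟩

/-- The pairings of `D` and `E` side by side.  The boundary word is
`u* v v* w`, where `*` reverses and dualizes. -/
def stack {u v w : List Bool} (D : Diagram u v) (E : Diagram v w) : ℕ → ℕ :=
  ins (u.length + v.length) (v.length + w.length) E.partner D.partner

/-- Concatenation: `D` is put on top of `E`, the points of the middle word are glued, and closed
loops are deleted. -/
def comp {u v w : List Bool} (D : Diagram u v) (E : Diagram v w) : Diagram u w where
  partner := glue u.length v.length (stack D E)
  planar := by
    have h := planar_ins (u := bdry u v) (v := []) (by simpa using D.planar) E.planar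
    have h := planar_glue (u := (u.map not).reverse) (m := v) (v := w) (by simpa [bdry] using h)
    simpa [bdry, stack] using h

/-- The number of closed loops (clockwise or not) deleted in `D.comp E`. -/
def numLoops {u v w : List Bool} (D : Diagram u v) (E : Diagram v w) : ℕ :=
  loops u.length v.length (stack D E)

/-- Horizontal juxtaposition, `D` on the left and `E` on the right. -/
def tensor {u u' v v' : List Bool} (D : Diagram u u') (E : Diagram v v') :
    Diagram (u ++ v) (u' ++ v') where
  partner := ins v.length (u.length + u'.length) D.partner E.partner
  planar := by
    have h := planar_ins (u := (v.map not).reverse) (v := v') E.planar D.planar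
    simpa [bdry] using h

theorem good {u v : List Bool} (D : Diagram u v) : Good (u.length + v.length) D.partner := by
  simpa [bdry] using D.planar.good

theorem comp_id {u v : List Bool} (D : Diagram u v) :
    D.comp (id v) = D ∧ D.numLoops (id v) = 0 := by
  obtain ⟨h1, h2⟩ := glue_id_right D.good le_rfl
  rw [two_mul] at h1 h2
  exact ⟨Diagram.ext h1, h2⟩

theorem id_comp {u v : List Bool} (D : Diagram u v) :
    (id u).comp D = D ∧ (id u).numLoops D = 0 := by
  obtain ⟨h1, h2⟩ := glue_id_left (s := 0) D.good (Nat.zero_add u.length) (Nat.le_add_right _ _)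
  have e : stack (id u) D = ins 0 (2 * u.length) (idp u.length) D.partner := by
    funext x
    simp only [stack, ins, id, idp, shift]
    have := D.good.out (x - (u.length + u.length))
    rw [show x - 2 * u.length = x - (u.length + u.length) by omega]
    split_ifs <;> omega
  refine ⟨Diagram.ext ?_, ?_⟩
  · simpa only [comp, e] using h1
  · simpa only [numLoops, e] using h2

theorem assoc {u v w z : List Bool} (D : Diagram u v) (E : Diagram v w) (F : Diagram w z) :
    (D.comp E).comp F = D.comp (E.comp F) ∧
    D.numLoops E + (D.comp E).numLoops F = E.numLoops F + D.numLoops (E.comp F) := by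
  have hDE : Good (u.length + w.length + 2 * v.length) (stack D E) := by
    have := D.good.ins E.good le_rfl
    rwa [show u.length + v.length + (v.length + w.length) =
      u.length + w.length + 2 * v.length by omega] at this
  have hEF : Good (v.length + z.length + 2 * w.length) (stack E F) := by
    have := E.good.ins F.good le_rfl
    rwa [show v.length + w.length + (w.length + z.length) =
      v.length + z.length + 2 * w.length by omega] at this
  obtain ⟨a1, a2⟩ := glue_ins_left (a := u.length) hDE F.good le_rfl (by omega)
  obtain ⟨b1, b2⟩ := glue_ins_mid (s := v.length) D.good hEF le_rfl (by omega)
  have e : ins (u.length + w.length + 2 * v.length) (w.length + z.length) F.partner (stack D E)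
      = ins (u.length + v.length) (v.length + z.length + 2 * w.length) (stack E F) D.partner := by
    have := ins_ins (t := u.length + v.length) (s := v.length + w.length) (l := v.length + w.length)
      (m := w.length + z.length) (p := D.partner) (q := E.partner) (r := F.partner) le_rfl
    simp only [stack]
    rw [show u.length + w.length + 2 * v.length = u.length + v.length + (v.length + w.length) by
      omega, this]
    congr 1
    omega
  obtain ⟨c1, c2⟩ := glue_glue (n := u.length + z.length) (a := u.length) (b := v.length)
    (c := w.length) (p := ins (u.length + w.length + 2 * v.length) (w.length + z.length) F.partner
      (stack D E)) (by
      have := hDE.ins F.good le_rfl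
      rwa [show u.length + w.length + 2 * v.length + (w.length + z.length) =
        u.length + z.length + 2 * w.length + 2 * v.length by omega] at this) (by omega)
  rw [a1, a2, e, show u.length + 2 * v.length = u.length + v.length + v.length by omega,
    b1, b2] at *
  exact ⟨Diagram.ext c1, c2⟩

/-- The arc `X ⊗ X* → I` (for `a = true`) or `X* ⊗ X → I` (for `a = false`). -/
def cap (a : Bool) : Diagram [a, !a] [] where
  partner := idp 1
  planar := by simpa [bdry] using planar_id [!a]

/-- The arc `I → X ⊗ X*` (for `a = true`) or `I → X* ⊗ X` (for `a = false`). -/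
def cup (a : Bool) : Diagram [] [a, !a] where
  partner := idp 1
  planar := by simpa [bdry] using planar_id [!a]

end Diagram

/-! ### The category of oriented Kauffman diagrams with both loop values equal to `d` -/

open CategoryTheory

/-- Objects of the category with loop value `d`: one object `X^w` for each word `w`. -/
structure KCat (d : ℂ) where
  word : List Bool

noncomputable section

/-- Bilinear extension of the concatenation of diagrams, each closed loop being replaced by
`d`. -/
def compHom (d : ℂ) (u v w : List Bool) :
    (Diagram u v →₀ ℂ) →ₗ[ℂ] (Diagram v w →₀ ℂ) →ₗ[ℂ] (Diagram u w →₀ ℂ) :=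
  Finsupp.linearCombination ℂ fun D =>
    Finsupp.linearCombination ℂ fun E => Finsupp.single (D.comp E) (d ^ D.numLoops E)

theorem compHom_single (d : ℂ) {u v w : List Bool} (D : Diagram u v) (E : Diagram v w) (a b : ℂ) :
    compHom d u v w (Finsupp.single D a) (Finsupp.single E b) =
      Finsupp.single (D.comp E) (a * b * d ^ D.numLoops E) := by
  rw [compHom, Finsupp.linearCombination_single, LinearMap.smul_apply,
    Finsupp.linearCombination_single, Finsupp.smul_single, Finsupp.smul_single, smul_eq_mul,
    smul_eq_mul, mul_assoc]

theorem compHom_id (d : ℂ) {u v : List Bool} (f : Diagram u v →₀ ℂ) :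
    compHom d u v v f (Finsupp.single (Diagram.id v) 1) = f := by
  induction f using Finsupp.induction_linear with
  | zero => simp
  | add f g hf hg => rw [map_add, LinearMap.add_apply, hf, hg]
  | single D a => rw [compHom_single, D.comp_id.1, D.comp_id.2]; simp

theorem id_compHom (d : ℂ) {u v : List Bool} (f : Diagram u v →₀ ℂ) :
    compHom d u u v (Finsupp.single (Diagram.id u) 1) f = f := by
  induction f using Finsupp.induction_linear with
  | zero => simp
  | add f g hf hg => rw [map_add, hf, hg]
  | single D a => rw [compHom_single, D.id_comp.1, D.id_comp.2]; simp

theorem compHom_assoc (d : ℂ) {u v w z : List Bool} (f : Diagram u v →₀ ℂ)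
    (g : Diagram v w →₀ ℂ) (h : Diagram w z →₀ ℂ) :
    compHom d u w z (compHom d u v w f g) h = compHom d u v z f (compHom d v w z g h) := by
  induction f using Finsupp.induction_linear with
  | zero => simp
  | add f f' hf hg => simp only [map_add, LinearMap.add_apply, hf, hg]
  | single D a =>
    induction g using Finsupp.induction_linear with
    | zero => simp
    | add f f' hf hg => simp only [map_add, LinearMap.add_apply, hf, hg]
    | single E b =>
      induction h using Finsupp.induction_linear with
      | zero => simp
      | add f f' hf hg => simp only [map_add, hf, hg]
      | single F c =>
        obtain ⟨h1, h2⟩ := Diagram.assoc D E F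
        simp only [compHom_single, h1]
        congr 1
        have : d ^ D.numLoops E * d ^ (D.comp E).numLoops F =
            d ^ E.numLoops F * d ^ D.numLoops (E.comp F) := by
          rw [← pow_add, ← pow_add, h2]
        linear_combination a * b * c * this

/-- Morphisms are formal complex linear combinations of diagrams. -/
instance (d : ℂ) : Category (KCat d) where
  Hom A B := Diagram A.word B.word →₀ ℂ
  id A := Finsupp.single (Diagram.id A.word) 1
  comp f g := compHom d _ _ _ f g
  id_comp f := id_compHom d f
  comp_id f := compHom_id d f
  assoc f g h := compHom_assoc d f g h

instance (d : ℂ) : Preadditive (KCat d) where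
  homGroup A B := inferInstanceAs (AddCommGroup (Diagram A.word B.word →₀ ℂ))
  add_comp A B C f f' g := by
    change compHom d _ _ _ (_ + _) _ = compHom d _ _ _ _ _ + compHom d _ _ _ _ _
    rw [map_add, LinearMap.add_apply]
  comp_add A B C f g g' := by
    change compHom d _ _ _ _ (_ + _) = compHom d _ _ _ _ _ + compHom d _ _ _ _ _
    rw [map_add]

instance (d : ℂ) : Linear ℂ (KCat d) where
  homModule A B := inferInstanceAs (Module ℂ (Diagram A.word B.word →₀ ℂ))
  smul_comp A B C r f g := by
    change compHom d _ _ _ (r • _) _ = r • compHom d _ _ _ _ _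
    rw [map_smul, LinearMap.smul_apply]
  comp_smul A B C f r g := by
    change compHom d _ _ _ _ (r • _) = r • compHom d _ _ _ _ _
    rw [map_smul]

/-- The morphism given by one diagram. -/
def ofDiagram (d : ℂ) {u v : List Bool} (D : Diagram u v) : (⟨u⟩ : KCat d) ⟶ ⟨v⟩ :=
  (Finsupp.single D 1 : Diagram u v →₀ ℂ)

/-- Bilinear extension of the juxtaposition of diagrams: the tensor product of morphisms. -/
def tensorHom {d : ℂ} {u u' v v' : List Bool} (f : (⟨u⟩ : KCat d) ⟶ ⟨u'⟩)
    (g : (⟨v⟩ : KCat d) ⟶ ⟨v'⟩) : (⟨u ++ v⟩ : KCat d) ⟶ ⟨u' ++ v'⟩ :=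
  Finsupp.linearCombination ℂ (fun D : Diagram u u' =>
    Finsupp.linearCombination ℂ (fun E : Diagram v v' =>
      (Finsupp.single (D.tensor E) 1 : Diagram (u ++ v) (u' ++ v') →₀ ℂ))) f g

/-! ### Jones-Wenzl idempotents and the objects `X_w` -/

/-- The alternating word with `n` letters that starts with `a`. -/
def alt : Bool → ℕ → List Bool
  | _, 0 => []
  | a, n + 1 => a :: alt (!a) n

/-- Quantum integers: `[0] = 0`, `[1] = 1`, `[n + 2] = d [n + 1] - [n]`; for `d = q + q⁻¹` this is
`[n] = (q ^ n - q ^ (-n)) / (q - q⁻¹)`. -/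
def qint (d : ℂ) : ℕ → ℂ
  | 0 => 0
  | 1 => 1
  | n + 2 => d * qint d (n + 1) - qint d n

/-- The Jones-Wenzl idempotent on the alternating word `alt a n`, by the recursive formula
`f₀ = 1`, `f₁ = 1`, `f_{n+1} = 1 ⊗ f_n - ([n] / [n + 1]) (1 ⊗ f_n) (e ⊗ 1) (1 ⊗ f_n)`, where `e` is
a cap followed by a cup on the first two strings.  It is meaningful if no `[n]` with
`n ≥ 1` vanishes. -/
def jonesWenzl (d : ℂ) : (a : Bool) → (n : ℕ) → ((⟨alt a n⟩ : KCat d) ⟶ ⟨alt a n⟩)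
  | _, 0 => 𝟙 _
  | _, 1 => 𝟙 _
  | a, n + 2 =>
    let g : (⟨alt a (n + 2)⟩ : KCat d) ⟶ ⟨alt a (n + 2)⟩ :=
      tensorHom (𝟙 (⟨[a]⟩ : KCat d)) (jonesWenzl d (!a) (n + 1))
    let e : (⟨alt a (n + 2)⟩ : KCat d) ⟶ ⟨alt a (n + 2)⟩ :=
      tensorHom (ofDiagram d (Diagram.cap a) ≫ ofDiagram d (Diagram.cup a))
        (𝟙 (⟨alt (!(!a)) n⟩ : KCat d))
    g - (qint d (n + 1) / qint d (n + 2)) • (g ≫ e ≫ g)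

/-- The factorization of a word into maximal alternating subwords; the pair `(a, n)` stands for the
factor `alt a n`. -/
def parts : List Bool → List (Bool × ℕ)
  | [] => []
  | a :: w =>
    match parts w with
    | [] => [(a, 1)]
    | (b, n) :: l => if b = !a then (a, n + 1) :: l else (a, 1) :: (b, n) :: l

/-- The product of a list of alternating words. -/
def partsWord : List (Bool × ℕ) → List Bool
  | [] => []
  | (a, n) :: l => alt a n ++ partsWord l

theorem partsWord_parts (w : List Bool) : partsWord (parts w) = w := by
  induction w with
  | nil => rfl
  | cons a w ih =>
    rw [parts]
    split
    · next h => rw [h] at ih; simp [partsWord, alt, ← ih]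
    · next b n l h =>
      rw [h] at ih
      split_ifs with hb
      · subst hb; simpa [partsWord, alt] using ih
      · simpa [partsWord, alt] using ih

/-- The tensor product of the Jones-Wenzl idempotents of the factors. -/
def partsProj (d : ℂ) : (l : List (Bool × ℕ)) → ((⟨partsWord l⟩ : KCat d) ⟶ ⟨partsWord l⟩)
  | [] => 𝟙 _
  | (a, n) :: l => tensorHom (jonesWenzl d a n) (partsProj d l)

/-- The endomorphism `P_w = f_{n₁} ⊗ ... ⊗ f_{n_l}` that cuts out `X_w`, where `n₁, ..., n_l` are the
lengths of the maximal alternating subwords of `w`.  The source is `X^w`, see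
`partsWord_parts`. -/
def proj (d : ℂ) (w : List Bool) :
    (⟨partsWord (parts w)⟩ : KCat d) ⟶ ⟨partsWord (parts w)⟩ :=
  partsProj d (parts w)

open Idempotents in
/-- The object `X_w` of the idempotent completion, given that `P_w` is idempotent. -/
def simpleObj (d : ℂ) (w : List Bool) (h : proj d w ≫ proj d w = proj d w) : Karoubi (KCat d) :=
  ⟨⟨partsWord (parts w)⟩, proj d w, h⟩

section Completion

open Idempotents

variable {C : Type*} [Category* C] [Preadditive C] [Linear ℂ C]

/-- Scalar multiplication on the morphisms of the idempotent completion. -/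
instance (P Q : Karoubi C) : SMul ℂ (P ⟶ Q) where
  smul c f := ⟨c • f.f, by rw [Linear.smul_comp, Linear.comp_smul, f.comm]⟩

/-- The idempotent completion of a complex linear category is complex linear. -/
instance : Linear ℂ (Karoubi C) where
  homModule P Q := Function.Injective.module ℂ
    (⟨⟨fun f : P ⟶ Q => f.f, rfl⟩, fun _ _ => rfl⟩ : (P ⟶ Q) →+ (P.X ⟶ Q.X))
    (fun _ _ h => Karoubi.hom_ext _ _ h) (fun _ _ => rfl)
  smul_comp _ _ _ r f g := Karoubi.hom_ext _ _ (Linear.smul_comp _ _ _ r f.f g.f)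
  comp_smul _ _ _ f r g := Karoubi.hom_ext _ _ (Linear.comp_smul _ _ _ f.f r g.f)

end Completion

end

end OrientedKauffman

open CategoryTheory OrientedKauffman

/-! The heart of the matter is that `proj d w` is annihilated, on both sides, by every diagram that
replaces two neighbouring vertical strings by a pair of arcs (`Kills`). If some string of a planar
diagram returns to its own side, an innermost such string joins two neighbours; otherwise the
diagram consists of vertical strings and its two words agree (`Diagram.trichotomy`). In the first
case the diagram is a scalar multiple of its own composite with a pair of arcs, because `d` is
invertible, so it dies between two such idempotents (`Kills.sandwich`). A morphism of the idempotent
completion equals its compression by the two idempotents; hence it is zero between different words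
and a multiple of `proj d w` when the words agree. The idempotent is nonzero because the identity
diagram has coefficient 1 in it: a product of diagrams is the identity only if both factors are, so
this coefficient is multiplicative for composition and juxtaposition (`coeff_id_comp`,
`coeff_id_tensor`).

An arc between neighbours either lies inside one alternating factor, where the Jones-Wenzl
idempotent kills it, or straddles the border of two maximal factors. There the two letters are
equal, so no oriented arc exists (`Kills.tensor`).

For the Jones-Wenzl idempotents, let `g` be a string next to the idempotent on `n + 1` strings and
`e` a cap followed by a cup on the first two strings. The partial trace formula expresses `e ≫ g ≫
e` as `[n + 2] / [n + 1]` times `e` composed with a smaller idempotent (`capCup_string_capCup`), and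
`wenzl_step` turns this into the next idempotent. The division by `[n + 2]` is where semisimplicity
enters: if `[n + 2] = 0`, then `x = g ≫ e ≫ g` satisfies `x ≫ f ≫ x = 0` for all `f`, so `x = 0`;
but `e` has coefficient 1 in `x` (`coeff_arcs`, `qint_ne_zero`). Thus the properties of the
idempotents and the nonvanishing of the quantum integers are obtained in a single induction
(`isJonesWenzl`). -/

namespace OrientedKauffman

/-! ### Gluing by following strings -/

/-- Starting at `x`, alternately follow a string of `p` and jump to the glued point, until the point
`y` (in the numbering after gluing `k` pairs around `a + k`) is reached. -/
inductive Chase (a k : ℕ) (p : ℕ → ℕ) (y : ℕ) : ℕ → Prop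
  | out {x : ℕ} : p x = shift a (2 * k) y → Chase a k p y x
  | step {x z : ℕ} : p x = z → a ≤ z → z < a + 2 * k → Chase a k p y (2 * a + 2 * k - 1 - z) →
      Chase a k p y x

/-- Contracting the innermost pair shortens a path by cutting out its passages through that pair.
The last two clauses handle a path that is about to enter the pair at one of its points: it
continues with the partner of the other one. They are needed for the induction along the path to
close. -/
theorem Chase.contract {n a k y : ℕ} {p : ℕ → ℕ} (hp : Good (n + 2 * (k + 1)) p) (ha : a ≤ n)
    {X : ℕ} (h : Chase a (k + 1) p y X) : ∀ x,
    (skip (a + k) (contract (a + k) p x) = p X → Chase a k (contract (a + k) p) y x) ∧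
    (p X = a + k → skip (a + k) (contract (a + k) p x) = p (a + k + 1) →
      Chase a k (contract (a + k) p) y x) ∧
    (p X = a + k + 1 → skip (a + k) (contract (a + k) p x) = p (a + k) →
      Chase a k (contract (a + k) p) y x) := by
  have hs : ∀ x, _ = _ := Good.skip (n := n + 2 * k) (i := a + k) hp (by omega)
  induction h with
  | @out X hX =>
    refine fun x => ⟨fun h => Chase.out (skip_inj (i := a + k) ?_), fun h => ?_, fun h => ?_⟩
    · rw [h, hX]; simp only [shift, skip]; split_ifs <;> omega
    · rw [hX] at h; simp only [shift] at h; split_ifs at h <;> omega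
    · rw [hX] at h; simp only [shift] at h; split_ifs at h <;> omega
  | @step X z hX h1 h2 _ ih =>
    refine fun x => ⟨fun h => ?_, fun h h' => ?_, fun h h' => ?_⟩
    · rw [hX] at h
      set z' := OrientedKauffman.contract (a + k) p x with hz'
      have hz : a ≤ z' ∧ z' < a + 2 * k ∧
          skip (a + k) (2 * a + 2 * k - 1 - z') = 2 * a + 2 * (k + 1) - 1 - z := by
        simp only [skip] at h ⊢; split_ifs at h ⊢ <;> omega
      refine Chase.step hz'.symm hz.1 hz.2.1 ?_
      have hj := hs (2 * a + 2 * k - 1 - z')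
      rw [hz.2.2] at hj
      obtain ⟨i1, i2, i3⟩ := ih (2 * a + 2 * k - 1 - z')
      simp only [join] at hj
      split_ifs at hj with c1 c2
      · exact i2 c1 hj
      · exact i3 c2 hj
      · exact i1 hj
    · refine (ih x).1 ?_
      rw [h', show 2 * a + 2 * (k + 1) - 1 - z = a + k + 1 by omega]
    · refine (ih x).1 ?_
      rw [h', show 2 * a + 2 * (k + 1) - 1 - z = a + k by omega]

/-- This turns the computation of a composite diagram into exhibiting a path, with no need to unfold
the recursion of `glue`. -/
theorem glue_eq_of_chase {n a k y x : ℕ} {p : ℕ → ℕ} (hp : Good (n + 2 * k) p) (ha : a ≤ n)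
    (h : Chase a k p y (shift a (2 * k) x)) : glue a k p x = y := by
  induction k generalizing p with
  | zero =>
    have e : ∀ z, shift a (2 * 0) z = z := by intro z; simp [shift]
    rw [e] at h
    cases h with
    | out h => rwa [e] at h
    | step h h1 h2 => omega
  | succ k ih =>
    refine ih (Good.contract (n := n + 2 * k) (i := a + k) hp (by omega)) ?_
    have e : shift a (2 * (k + 1)) x = skip (a + k) (shift a (2 * k) x) := by
      simp only [shift, skip]; split_ifs <;> omega
    have hs := Good.skip (n := n + 2 * k) (i := a + k) hp (by omega) (shift a (2 * k) x)
    obtain ⟨i1, i2, i3⟩ := h.contract hp ha (shift a (2 * k) x)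
    rw [← e] at hs
    simp only [join] at hs
    split_ifs at hs with c1 c2
    · exact i2 c1 hs
    · exact i3 c2 hs
    · exact i1 hs

/-! ### Gluing and juxtaposition -/

theorem contract_ins_right {n t l i : ℕ} {p q : ℕ → ℕ} (hp : Good (n + 2) p) (hq : Good l q)
    (hi : i ≤ n) (ht : t ≤ i) : contract (i + l) (ins t l q p) = ins t l q (contract i p) := by
  have g := hp.ins hq (show t ≤ n + 2 by omega)
  rw [show n + 2 + l = n + l + 2 by omega] at g
  have e : ∀ z, skip (i + l) (shift t l z) = shift t l (skip i z) := by
    intro z; simp only [shift, skip]; split_ifs <;> omega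
  have e' : ∀ z w, shift t l z = shift t l w ↔ z = w := by
    intro z w; simp only [shift]; split_ifs <;> omega
  have f1 : i + l = shift t l i := by simp only [shift]; split_ifs <;> omega
  have f2 : i + l + 1 = shift t l (i + 1) := by simp only [shift]; split_ifs <;> omega
  funext x
  apply skip_inj (i := i + l)
  rw [g.skip (by omega)]
  obtain ⟨y, rfl⟩ | ⟨y, hy, rfl⟩ := shift_or t l x
  · rw [ins_shift, e, e, hp.skip (by omega), f2, f1]
    simp only [join, ins_shift, e', apply_ite (shift t l)]
  · have := hq.lt hy
    rw [ins_mid _ _ hy, skip_lo (by omega), skip_lo (by omega)]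
    simp only [join]
    rw [ins_mid _ _ hy, if_neg (by omega), if_neg (by omega)]

theorem glue_ins_right {n t l a k : ℕ} {p q : ℕ → ℕ} (hp : Good (n + 2 * k) p) (hq : Good l q)
    (ha : a ≤ n) (ht : t ≤ a) :
    glue (a + l) k (ins t l q p) = ins t l q (glue a k p) ∧
    loops (a + l) k (ins t l q p) = loops a k p := by
  induction k generalizing p with
  | zero => exact ⟨rfl, rfl⟩
  | succ k ih =>
    have h := contract_ins_right (i := a + k) (t := t) (n := n + 2 * k) hp hq
      (by omega) (by omega)
    obtain ⟨h1, h2⟩ := ih (hp.contract (by omega : a + k ≤ n + 2 * k))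
    simp only [glue, loops]
    rw [show a + l + k = a + k + l by omega, h, h1, h2]
    refine ⟨rfl, ?_⟩
    congr 1
    have e : ins t l q p (a + k + l) = shift t l (p (a + k)) := by
      rw [← ins_shift]; congr 1; simp only [shift]; split_ifs <;> omega
    simp only [loopAt, e, shift]
    split_ifs <;> omega

theorem glue_add (a k m : ℕ) (p : ℕ → ℕ) :
    glue a (k + m) p = glue a k (glue (a + k) m p) ∧
    loops a (k + m) p = loops (a + k) m p + loops a k (glue (a + k) m p) := by
  induction m generalizing p with
  | zero => simp [glue, loops]
  | succ m ih =>
    rw [← add_assoc]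
    simp only [glue, loops, ih, ← add_assoc]
    exact ⟨trivial, trivial⟩

theorem ins_comm {t t' l m : ℕ} {p q r : ℕ → ℕ} (hq : Good l q) (ht : t ≤ t') :
    ins (t' + l) m r (ins t l q p) = ins t l q (ins t' m r p) := by
  have e : ∀ z, shift (t' + l) m (shift t l z) = shift t l (shift t' m z) := by
    intro z; simp only [shift]; split_ifs <;> omega
  have f : ∀ z, t' + l + z = shift t l (t' + z) := by
    intro z; simp only [shift]; split_ifs <;> omega
  have f' : ∀ z, z < l → t + z = shift (t' + l) m (t + z) := by
    intro z hz; simp only [shift]; split_ifs <;> omega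
  funext x
  obtain ⟨y, rfl⟩ | ⟨y, hy, rfl⟩ := shift_or (t' + l) m x
  · rw [ins_shift]
    obtain ⟨y, rfl⟩ | ⟨y, hy, rfl⟩ := shift_or t l y
    · rw [e, ins_shift, ins_shift, ins_shift, e]
    · rw [← f' _ hy, ins_mid _ _ hy, ins_mid _ _ hy, ← f' _ (hq.lt hy)]
  · rw [ins_mid _ _ hy, f, f, ins_shift, ins_mid _ _ hy]

namespace Diagram

/-- The interchange law. Around the stacked picture one reads `v* u* u' v' v'* u'* u'' v''`. The
glued `v'`-pairs are innermost; once they are gone, `D` and `D'` are adjacent, and the remaining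
gluing of `u'` takes place inside the block that they form. -/
theorem comp_tensor {u u' u'' v v' v'' : List Bool} (D : Diagram u u') (D' : Diagram u' u'')
    (E : Diagram v v') (E' : Diagram v' v'') :
    (D.tensor E).comp (D'.tensor E') = (D.comp D').tensor (E.comp E') ∧
    (D.tensor E).numLoops (D'.tensor E') = D.numLoops D' + E.numLoops E' := by
  have gS : Good (v.length + v''.length + 2 * v'.length) (stack E E') := by
    have := E.good.ins E'.good le_rfl
    rwa [show v.length + v'.length + (v'.length + v''.length) =
      v.length + v''.length + 2 * v'.length by omega] at this
  have gT : Good (u.length + u''.length + 2 * u'.length) (stack D D') := by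
    have := D.good.ins D'.good le_rfl
    rwa [show u.length + u'.length + (u'.length + u''.length) =
      u.length + u''.length + 2 * u'.length by omega] at this
  -- The same picture, built from `stack E E'` by inserting first `D'` and then `D`.
  have e : stack (D.tensor E) (D'.tensor E') =
      ins v.length (u.length + u'.length) D.partner (ins (v.length + 2 * v'.length)
        (u'.length + u''.length) D'.partner (stack E E')) := by
    rw [← ins_comm D.good (by omega)]
    simp only [stack]
    rw [← ins_comm D.good (by omega)]
    simp only [tensor, List.length_append]
    rw [show v.length + 2 * v'.length + (u.length + u'.length) =
      v.length + v'.length + (u.length + u'.length) + v'.length by omega,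
      ins_ins (by omega)]
    congr 1 <;> omega
  have gI : Good (v.length + v''.length + (u'.length + u''.length) + 2 * v'.length)
      (ins (v.length + 2 * v'.length) (u'.length + u''.length) D'.partner (stack E E')) := by
    have := gS.ins D'.good (t := v.length + 2 * v'.length) (by omega)
    rwa [show v.length + v''.length + 2 * v'.length + (u'.length + u''.length) =
      v.length + v''.length + (u'.length + u''.length) + 2 * v'.length by omega] at this
  obtain ⟨a1, a2⟩ := glue_ins_right (t := v.length) (a := v.length) gI D.good (by omega) le_rfl
  obtain ⟨b1, b2⟩ := glue_ins_left (t := v.length) (a := v.length) gS D'.good (by omega) le_rfl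
  obtain ⟨c1, c2⟩ := glue_ins_mid (t := v.length) (s := u.length) (E.comp E').good gT
    (by omega) (by omega)
  obtain ⟨d1, d2⟩ := glue_add (v.length + u.length) u'.length v'.length
    (stack (D.tensor E) (D'.tensor E'))
  have f : ins v.length (u.length + u'.length) D.partner
      (ins v.length (u'.length + u''.length) D'.partner (E.comp E').partner) =
      ins v.length (u.length + u''.length + 2 * u'.length) (stack D D') (E.comp E').partner := by
    rw [← ins_comm D.good le_rfl, ins_ins le_rfl]
    simp only [stack]
    congr 1
    omega
  have e1 : glue (v.length + u.length + u'.length) v'.length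
      (stack (D.tensor E) (D'.tensor E')) =
      ins v.length (u.length + u''.length + 2 * u'.length) (stack D D') (E.comp E').partner := by
    rw [e, add_assoc v.length, a1, b1, ← f]
    rfl
  have e2 : loops (v.length + u.length + u'.length) v'.length
      (stack (D.tensor E) (D'.tensor E')) = E.numLoops E' := by
    rw [e, add_assoc v.length, a2, b2]
    rfl
  rw [e1] at d1 d2
  rw [c1] at d1
  rw [c2, e2] at d2
  constructor
  · apply Diagram.ext
    simp only [comp, List.length_append]
    rw [add_comm u.length v.length, d1]
    simp only [tensor, comp]
  · simp only [numLoops, List.length_append] at d2 ⊢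
    rw [add_comm u.length v.length, d2, add_comm]

theorem id_tensor_id (u v : List Bool) : (id u).tensor (id v) = id (u ++ v) := by
  apply Diagram.ext
  funext x
  simp only [tensor, id, ins, idp, shift, List.length_append]
  split_ifs <;> omega

theorem tensor_assoc {u u' v v' w w' : List Bool} (D : Diagram u u') (E : Diagram v v')
    (F : Diagram w w') :
    ((D.tensor E).tensor F).partner = (D.tensor (E.tensor F)).partner := by
  simp only [tensor, List.length_append]
  rw [add_comm v.length, ins_ins (by omega)]
  congr 1
  omega

end Diagram

/-! ### Diagrams with a single pair of arcs -/

/-- Boundary pairing of `N` vertical strings, two of which are replaced by an arc from `x` to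
`x + 1` on the upper line and the arc below it on the lower line. -/
def turnp (N x y : ℕ) : ℕ :=
  if y = x then x + 1
  else if y = x + 1 then x
  else if y + x + 1 = 2 * N then y - 1
  else if y + x + 2 = 2 * N then y + 1
  else idp N y

/-- The letters at the points `x`, `x + 1` of the upper line are opposite. -/
def Opp (w : List Bool) (x : ℕ) : Prop :=
  x + 1 < w.length ∧ (w.map not).reverse[x + 1]? = (w.map not).reverse[x]?.map not

theorem turnp_cases {N x : ℕ} (h : x + 1 < N) (y : ℕ) :
    y = x ∧ turnp N x y = x + 1 ∨ y = x + 1 ∧ turnp N x y = x ∨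
    y + x + 1 = 2 * N ∧ turnp N x y + 1 = y ∨ y + x + 2 = 2 * N ∧ turnp N x y = y + 1 ∨
    2 * N ≤ y ∧ turnp N x y = y ∨
    y < 2 * N ∧ y ≠ x ∧ y ≠ x + 1 ∧ y + x + 1 ≠ 2 * N ∧ y + x + 2 ≠ 2 * N ∧
      turnp N x y + y + 1 = 2 * N := by
  simp only [turnp, idp]
  split_ifs <;> omega

theorem turnp_good {N x : ℕ} (h : x + 1 < N) : Good (2 * N) (turnp N x) := by
  refine ⟨fun y => ?_, fun y hy => ?_, fun y hy => ?_⟩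
  · have h1 := turnp_cases h y
    generalize turnp N x y = z at *
    have h2 := turnp_cases h z
    omega
  · have := turnp_cases h y
    omega
  · have := turnp_cases h y
    omega

theorem not_eq_map_not {a b : Option Bool} (h : b = a.map not) : a = b.map not := by
  subst h; cases a <;> simp

/-- The orientation only needs attention at the four ends of arcs. Mirror points of the upper and
lower line carry opposite letters of `bdry w w`, so the lower arc inherits its opposite letters from
the upper one. -/
theorem planar_turnp {w : List Bool} {x : ℕ} (h : Opp w x) :
    IsPlanar (bdry w w) (turnp w.length x) := by
  obtain ⟨hx, ho⟩ := h
  have g := turnp_good hx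
  have hl : (bdry w w).length = 2 * w.length := by simp [bdry]; omega
  have o := (planar_id w).orient
  change ∀ x, (bdry w w)[_]? = (bdry w w)[x]?.map not at o
  have ho' : (bdry w w)[x + 1]? = (bdry w w)[x]?.map not := by
    simp only [bdry]
    rw [List.getElem?_append_left (by simp; omega), List.getElem?_append_left (by simp; omega), ho]
  have o1 := o x
  have o2 := o (x + 1)
  simp only [idp, if_pos (show x < 2 * w.length by omega)] at o1
  simp only [idp, if_pos (show x + 1 < 2 * w.length by omega)] at o2
  refine ⟨g.invol, fun y hy => g.out y (by omega), fun y => ?_, fun y z h1 h2 => ?_⟩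
  · simp only [turnp]
    split_ifs with c1 c2 c3 c4
    · rw [c1, ho']
    · rw [c2]; exact not_eq_map_not ho'
    · rw [show y - 1 = 2 * w.length - 1 - (x + 1) by omega,
        show y = 2 * w.length - 1 - x by omega, o1, o2, ho']
    · rw [show y + 1 = 2 * w.length - 1 - x by omega,
        show y = 2 * w.length - 1 - (x + 1) by omega, o1, o2, ho']
      exact not_eq_map_not rfl
    · exact o y
  · have c1 := turnp_cases hx y
    have c2 := turnp_cases hx z
    omega

namespace Diagram

/-- Vertical strings, two of which are replaced by a pair of arcs. -/
def turn (w : List Bool) (x : ℕ) (h : Opp w x) : Diagram w w := ⟨turnp w.length x, planar_turnp h⟩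

theorem stack_good {u v w : List Bool} (D : Diagram u v) (E : Diagram v w) :
    Good (u.length + w.length + 2 * v.length) (stack D E) := by
  have := D.good.ins E.good le_rfl
  rwa [show u.length + v.length + (v.length + w.length) =
    u.length + w.length + 2 * v.length by omega] at this

theorem comp_eq_of_chase {u v w : List Bool} (D : Diagram u v) (E : Diagram v w) {x y : ℕ}
    (h : Chase u.length v.length (stack D E) y (shift u.length (2 * v.length) x)) :
    (D.comp E).partner x = y :=
  glue_eq_of_chase (stack_good D E) (Nat.le_add_right _ _) h

theorem stack_left {u v w : List Bool} (D : Diagram u v) (E : Diagram v w) {x : ℕ}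
    (h : x < u.length + v.length) : stack D E x = D.partner x := by
  have := D.good.lt h
  simp only [stack, ins, shift]
  split_ifs; rfl

theorem stack_right {u v w : List Bool} (D : Diagram u v) (E : Diagram v w) (x : ℕ) :
    stack D E (u.length + v.length + x) = u.length + v.length + E.partner x := by
  by_cases h : x < v.length + w.length
  · exact ins_mid _ _ h
  · rw [E.good.out x (by omega)]
    simp only [stack, ins, shift]
    have := D.good.out (u.length + v.length + x - (v.length + w.length)) (by omega)
    split_ifs <;> omega

/-- An arc on the upper line survives composition. -/
theorem comp_top {u v w : List Bool} (D : Diagram u v) (E : Diagram v w) {x : ℕ}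
    (h : x < u.length) (h' : D.partner x < u.length) : (D.comp E).partner x = D.partner x := by
  refine comp_eq_of_chase D E (Chase.out ?_)
  have : shift u.length (2 * v.length) x = x := by simp [shift, h]
  rw [this, stack_left _ _ (by omega)]
  simp [shift, h']

/-- An arc on the lower line survives composition. -/
theorem comp_bot {u v w : List Bool} (D : Diagram u v) (E : Diagram v w) {x : ℕ}
    (h' : v.length ≤ E.partner (v.length + x)) :
    (D.comp E).partner (u.length + x) = u.length + (E.partner (v.length + x) - v.length) := by
  refine comp_eq_of_chase D E (Chase.out ?_)
  have : shift u.length (2 * v.length) (u.length + x) = u.length + v.length + (v.length + x) := by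
    simp only [shift]; split_ifs <;> omega
  rw [this, stack_right]
  simp only [shift]
  split_ifs <;> omega

/-- The upper arc of the turn takes the place of the arc of `D`, and every other string is prolonged
by vertical strings. The lower arc of the turn and the arc of `D` close up to a loop that no path
from the boundary meets. -/
theorem turn_comp {u w : List Bool} (D : Diagram u w) {x : ℕ} (h : Opp u x)
    (hD : D.partner x = x + 1) : (turn u x h).comp D = D := by
  have hx := h.1
  have hD' : D.partner (x + 1) = x := by rw [← hD, D.good.invol]
  have inv := D.good.invol
  have sl : ∀ y, y < 2 * u.length → stack (turn u x h) D y = turnp u.length x y :=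
    fun y hy => stack_left _ _ (by omega)
  have sr := stack_right (turn u x h) D
  apply Diagram.ext
  funext y
  refine comp_eq_of_chase _ D ?_
  /- the end of the path, once the upper end of a string of `D` has been reached -/
  have fin : ∀ z, z ≠ x → z ≠ x + 1 → Chase u.length u.length (stack (turn u x h) D)
      (D.partner z) (u.length + u.length + z) := by
    intro z h1 h2
    have n1 : D.partner z ≠ x := fun e => h2 (by rw [← inv z, e, hD])
    have n2 : D.partner z ≠ x + 1 := fun e => h1 (by rw [← inv z, e, hD'])
    by_cases c : D.partner z < u.length
    · refine Chase.step (sr z) (by omega) (by omega) (Chase.out ?_)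
      rw [sl _ (by omega)]
      simp only [turnp, idp, shift]
      split_ifs <;> omega
    · refine Chase.out ?_
      rw [sr]
      simp only [shift]
      split_ifs; omega
  by_cases c : y < u.length
  · have e : shift u.length (2 * u.length) y = y := by simp [shift, c]
    rw [e]
    by_cases c1 : y = x
    · refine Chase.out ?_
      rw [sl _ (by omega), c1, hD]
      simp only [turnp, shift]
      split_ifs <;> omega
    by_cases c2 : y = x + 1
    · refine Chase.out ?_
      rw [sl _ (by omega), c2, hD']
      simp only [turnp, shift]
      split_ifs <;> omega
    have e : turnp u.length x y = 2 * u.length - 1 - y := by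
      simp only [turnp, idp]; split_ifs <;> omega
    refine Chase.step ((sl _ (by omega)).trans e) (by omega) (by omega) ?_
    have := fin y c1 c2
    rwa [show 2 * u.length + 2 * u.length - 1 - (2 * u.length - 1 - y) =
      u.length + u.length + y by omega]
  · have := fin y (by omega) (by omega)
    have e : shift u.length (2 * u.length) y = u.length + u.length + y := by
      simp only [shift]; split_ifs; omega
    rwa [e]

/-- The mirror image of `turn_comp`. Upper points are counted from the right and lower points from
the left, so the lower arc below `x`, `x + 1` ends at the lower points `w.length - 1 - x` and
`w.length - 2 - x`. -/
theorem comp_turn {u w : List Bool} (D : Diagram u w) {x : ℕ} (h : Opp w x)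
    (hD : D.partner (u.length + (w.length - 2 - x)) = u.length + (w.length - 1 - x)) :
    D.comp (turn w x h) = D := by
  have hx := h.1
  have hD' : D.partner (u.length + (w.length - 1 - x)) = u.length + (w.length - 2 - x) := by
    rw [← hD, D.good.invol]
  have inv := D.good.invol
  have sl : ∀ y, y < u.length + w.length → stack D (turn w x h) y = D.partner y :=
    fun y hy => stack_left _ _ (by omega)
  have sr : ∀ y, stack D (turn w x h) _ = _ + turnp w.length x y := stack_right D (turn w x h)
  apply Diagram.ext
  funext y
  refine comp_eq_of_chase D _ ?_
  -- A string of `D` other than the arc either ends on the upper line or is prolonged by one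
  -- vertical string of the turn.
  have fin : ∀ z, z < u.length + w.length → z ≠ u.length + (w.length - 2 - x) →
      z ≠ u.length + (w.length - 1 - x) → Chase u.length w.length (stack D (turn w x h))
      (D.partner z) z := by
    intro z h0 h1 h2
    have n0 := D.good.lt h0
    have n1 : D.partner z ≠ u.length + (w.length - 2 - x) := fun e => h2 (by rw [← inv z, e, hD])
    have n2 : D.partner z ≠ u.length + (w.length - 1 - x) := fun e => h1 (by rw [← inv z, e, hD'])
    by_cases c : D.partner z < u.length
    · refine Chase.out ?_
      rw [sl _ h0]
      simp [shift, c]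
    · refine Chase.step (sl z h0) (by omega) (by omega) (Chase.out ?_)
      rw [show 2 * u.length + 2 * w.length - 1 - D.partner z =
        u.length + w.length + (u.length + w.length - 1 - D.partner z) by omega, sr]
      have := turnp_cases hx (u.length + w.length - 1 - D.partner z)
      simp only [shift]
      split_ifs; omega
  by_cases c : y < u.length
  · have e : shift u.length (2 * w.length) y = y := by simp [shift, c]
    rw [e]
    exact fin y (by omega) (by omega) (by omega)
  · have e : shift u.length (2 * w.length) y = u.length + w.length + (w.length + (y - u.length)) := by
      simp only [shift]; split_ifs; omega
    rw [e]
    by_cases c1 : y = u.length + (w.length - 2 - x)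
    · refine Chase.out ?_
      rw [sr, c1, hD]
      have := turnp_cases hx (w.length + (u.length + (w.length - 2 - x) - u.length))
      simp only [shift]
      split_ifs <;> omega
    by_cases c2 : y = u.length + (w.length - 1 - x)
    · refine Chase.out ?_
      rw [sr, c2, hD']
      have := turnp_cases hx (w.length + (u.length + (w.length - 1 - x) - u.length))
      simp only [shift]
      split_ifs <;> omega
    by_cases c3 : y < u.length + w.length
    · have e : turnp w.length x (w.length + (y - u.length)) = w.length - 1 - (y - u.length) := by
        have := turnp_cases hx (w.length + (y - u.length))
        omega
      refine Chase.step (sr _) (by omega) (by omega) ?_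
      rw [e]
      have := fin y c3 c1 c2
      rwa [show 2 * u.length + 2 * w.length - 1 - (u.length + w.length +
        (w.length - 1 - (y - u.length))) = y by omega]
    · refine Chase.out ?_
      rw [sr, D.good.out y (by omega)]
      have := turnp_cases hx (w.length + (y - u.length))
      simp only [shift]
      split_ifs; omega

theorem opp_append_left {u v : List Bool} {x : ℕ} (h : Opp (u ++ v) x) (hx : v.length ≤ x) :
    Opp u (x - v.length) := by
  obtain ⟨h1, h2⟩ := h
  rw [List.length_append] at h1
  refine ⟨by omega, ?_⟩
  simp only [List.map_append, List.reverse_append] at h2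
  rw [List.getElem?_append_right (by simp; omega), List.getElem?_append_right (by simp; omega)] at h2
  simp only [List.length_reverse, List.length_map] at h2
  rwa [show x - v.length + 1 = x + 1 - v.length by omega]

theorem opp_append_right {u v : List Bool} {x : ℕ} (h : Opp (u ++ v) x) (hx : x + 1 < v.length) :
    Opp v x := by
  obtain ⟨h1, h2⟩ := h
  refine ⟨by omega, ?_⟩
  simp only [List.map_append, List.reverse_append] at h2
  rwa [List.getElem?_append_left (by simp; omega), List.getElem?_append_left (by simp; omega)] at h2

/-- Upper points are numbered from the right, so the right factor `v` occupies the numbers below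
`v.length`. -/
theorem turn_tensor_id {u v : List Bool} {x : ℕ} (h : Opp (u ++ v) x) (hx : v.length ≤ x) :
    (turn u (x - v.length) (opp_append_left h hx)).tensor (id v) = turn (u ++ v) x h := by
  have := h.1
  rw [List.length_append] at this
  apply Diagram.ext
  funext y
  simp only [tensor, turn, id, List.length_append]
  obtain ⟨y, rfl⟩ | ⟨y, hy, rfl⟩ := shift_or v.length (u.length + u.length) y
  · rw [ins_shift]
    have := turnp_cases this (shift v.length (u.length + u.length) y)
    simp only [shift, idp] at *
    split_ifs at * <;> omega
  · rw [ins_mid _ _ hy]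
    have := turnp_cases this (v.length + y)
    have := turnp_cases (show x - v.length + 1 < u.length by omega) y
    omega

theorem id_tensor_turn {u v : List Bool} {x : ℕ} (h : Opp (u ++ v) x) (hx : x + 1 < v.length) :
    (id u).tensor (turn v x (opp_append_right h hx)) = turn (u ++ v) x h := by
  apply Diagram.ext
  funext y
  have hN := h.1
  rw [List.length_append] at hN
  simp only [tensor, turn, id, List.length_append]
  obtain ⟨y, rfl⟩ | ⟨y, hy, rfl⟩ := shift_or v.length (u.length + u.length) y
  · rw [ins_shift]
    have := turnp_cases hN (shift v.length (u.length + u.length) y)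
    have := turnp_cases hx y
    simp only [shift] at *
    split_ifs at * <;> omega
  · rw [ins_mid _ _ hy]
    have := turnp_cases hN (v.length + y)
    simp only [idp]
    split_ifs <;> omega

end Diagram

/-! ### Diagrams without arcs -/

/-- An innermost string below the given one joins neighbours: if `p x ≠ x + 1`, the string from `x +
1` is trapped under the string from `x` and is strictly shorter. -/
theorem IsPlanar.exists_adjacent {v : List Bool} {p : ℕ → ℕ} (hp : IsPlanar v p) {x : ℕ}
    (h : x < p x) : ∃ y, x ≤ y ∧ y + 1 ≤ p x ∧ p y = y + 1 := by
  induction hn : p x - x using Nat.strong_induction_on generalizing x with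
  | _ n ih =>
    by_cases c : p x = x + 1
    · exact ⟨x, le_rfl, by omega, c⟩
    have hlt : p x < v.length := by
      by_contra hh
      have := hp.outside _ (not_lt.1 hh)
      rw [hp.invol] at this
      omega
    have h1 := hp.noncross x (x + 1) (by omega) (by omega)
    have h2 := hp.ne (x := x + 1) (by omega)
    have h3 : x < p (x + 1) := by
      by_contra h4
      have h5 : p (x + 1) ≠ x := fun e => c (by
        have := congrArg p e
        rw [hp.invol] at this
        omega)
      have := hp.noncross (p (x + 1)) x (by omega) (by rw [hp.invol]; omega)
      rw [hp.invol] at this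
      omega
    obtain ⟨y, y1, y2, y3⟩ := ih _ (by omega) (x := x + 1) (by omega) rfl
    exact ⟨y, by omega, by omega, y3⟩

namespace Diagram

theorem opp_of_top {u w : List Bool} (D : Diagram u w) {x : ℕ} (hx : x + 1 < u.length)
    (h : D.partner x = x + 1) : Opp u x := by
  refine ⟨hx, ?_⟩
  have := D.planar.orient x
  rw [h] at this
  simp only [bdry] at this
  rwa [List.getElem?_append_left (by simp; omega), List.getElem?_append_left (by simp; omega)] at this

theorem opp_of_bot {u w : List Bool} (D : Diagram u w) {x : ℕ} (hx : x + 1 < w.length)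
    (h : D.partner (u.length + (w.length - 2 - x)) = u.length + (w.length - 1 - x)) : Opp w x := by
  refine ⟨hx, ?_⟩
  have := D.planar.orient (u.length + (w.length - 2 - x))
  rw [h] at this
  simp only [bdry] at this
  rw [List.getElem?_append_right (by simp), List.getElem?_append_right (by simp)] at this
  simp only [List.length_reverse, List.length_map, Nat.add_sub_cancel_left] at this
  rw [List.getElem?_reverse (by simpa using hx), List.getElem?_reverse (by simp; omega)]
  simp only [List.length_map, List.getElem?_map]
  rw [show w.length - 1 - (x + 1) = w.length - 2 - x by omega, this]
  cases w[w.length - 2 - x]? <;> simp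

theorem partner_lt {u w : List Bool} (D : Diagram u w) {x : ℕ} (h : x < D.partner x) :
    D.partner x < u.length + w.length := by
  by_contra hh
  have := D.good.out _ (not_lt.1 hh)
  rw [D.good.invol] at this
  omega

/-- Upper points are joined to lower points or there is an arc between adjacent upper points. -/
theorem top_or {u w : List Bool} (D : Diagram u w) :
    (∃ x, x + 1 < u.length ∧ D.partner x = x + 1) ∨
    ∀ x, x < u.length → u.length ≤ D.partner x ∧ D.partner x < u.length + w.length := by
  by_cases h1 : ∃ x, x < D.partner x ∧ D.partner x < u.length
  · obtain ⟨x, h1, h2⟩ := h1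
    obtain ⟨y, y1, y2, y3⟩ := D.planar.exists_adjacent h1
    exact Or.inl ⟨y, by omega, y3⟩
  push Not at h1
  refine Or.inr fun x hx => ⟨?_, D.good.lt (by omega)⟩
  by_contra h
  have a1 := h1 x
  have a2 := h1 (D.partner x)
  rw [D.good.invol] at a2
  have := D.good.ne x (by omega)
  omega

/-- Lower points are joined to upper points or there is an arc between adjacent lower points. -/
theorem bot_or {u w : List Bool} (D : Diagram u w) :
    (∃ x, x + 1 < w.length ∧
      D.partner (u.length + (w.length - 2 - x)) = u.length + (w.length - 1 - x)) ∨
    ∀ x, u.length ≤ x → x < u.length + w.length → D.partner x < u.length := by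
  by_cases h2 : ∃ x, u.length ≤ x ∧ x < D.partner x
  · obtain ⟨x, h1, h2⟩ := h2
    obtain ⟨y, y1, y2, y3⟩ := D.planar.exists_adjacent h2
    have := D.partner_lt h2
    refine Or.inl ⟨w.length - 2 - (y - u.length), by omega, ?_⟩
    rw [show u.length + (w.length - 2 - (w.length - 2 - (y - u.length))) = y by omega, y3]
    omega
  push Not at h2
  refine Or.inr fun x hx hx' => ?_
  by_contra h
  have a1 := h2 x hx
  have a2 := h2 (D.partner x) (by omega)
  rw [D.good.invol] at a2
  have := D.good.ne x (by omega)
  omega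

theorem partner_injective {u w : List Bool} (D : Diagram u w) : Function.Injective D.partner :=
  Function.Involutive.injective D.good.invol

/-- Noncrossing makes `D.partner` strictly decreasing on the upper points, and a strictly decreasing
map between intervals of equal length is the reversal. `lo` and `hi` squeeze its values from above
and from below. -/
theorem partner_eq_idp {u w : List Bool} (D : Diagram u w) (hl : u.length = w.length)
    (top : ∀ x, x < u.length → u.length ≤ D.partner x ∧ D.partner x < u.length + w.length) :
    D.partner = idp u.length := by
  have inv := D.good.invol
  have anti : ∀ x y, x < y → y < u.length → D.partner y < D.partner x := fun x y h h' =>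
    D.planar.noncross x y h (by have := top x (by omega); omega)
  have lo : ∀ x, x < u.length → D.partner x + x + 1 ≤ u.length + w.length := by
    intro x
    induction x with
    | zero => intro h; have := top 0 h; omega
    | succ x ih =>
      intro h
      have := ih (by omega)
      have := anti x (x + 1) (by omega) h
      omega
  have hi : ∀ k, ∀ x, x + k + 1 = u.length → u.length + k ≤ D.partner x := by
    intro k
    induction k with
    | zero => intro x h; exact (top x (by omega)).1
    | succ k ih =>
      intro x h
      have := ih (x + 1) (by omega)
      have := anti x (x + 1) (by omega) (by omega)
      omega
  have key : ∀ x, x < u.length → D.partner x = 2 * u.length - 1 - x := by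
    intro x hx
    have := lo x hx
    have := hi (u.length - 1 - x) x (by omega)
    omega
  funext x
  simp only [idp]
  split_ifs with h
  · by_cases c : x < u.length
    · exact key x c
    · have := key (2 * u.length - 1 - x) (by omega)
      rw [← inv (2 * u.length - 1 - x), this]
      congr 1
      omega
  · exact D.good.out x (by omega)

theorem length_le_of_top {u w : List Bool} (D : Diagram u w)
    (top : ∀ x, x < u.length → u.length ≤ D.partner x ∧ D.partner x < u.length + w.length) :
    u.length ≤ w.length := by
  have := Finset.card_le_card_of_injOn (s := Finset.range u.length)
    (t := Finset.Ico u.length (u.length + w.length)) D.partner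
    (fun x hx => by simpa using top x (by simpa using hx)) D.partner_injective.injOn
  simpa using this

theorem length_le_of_bot {u w : List Bool} (D : Diagram u w)
    (bot : ∀ x, u.length ≤ x → x < u.length + w.length → D.partner x < u.length) :
    w.length ≤ u.length := by
  have := Finset.card_le_card_of_injOn (t := Finset.range u.length)
    (s := Finset.Ico u.length (u.length + w.length)) D.partner
    (fun x hx => by
      have hx : u.length ≤ x ∧ x < u.length + w.length := by simpa using hx
      simpa using bot x hx.1 hx.2) D.partner_injective.injOn
  simpa using this

/-- A diagram has adjacent upper points that are joined, or adjacent lower points that are joined,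
or it consists of vertical strings. -/
theorem trichotomy {u w : List Bool} (D : Diagram u w) :
    (∃ x, x + 1 < u.length ∧ D.partner x = x + 1) ∨
    (∃ x, x + 1 < w.length ∧
      D.partner (u.length + (w.length - 2 - x)) = u.length + (w.length - 1 - x)) ∨
    (u = w ∧ D.partner = idp u.length) := by
  rcases D.top_or with h | top
  · exact Or.inl h
  rcases D.bot_or with h | bot
  · exact Or.inr (Or.inl h)
  have len : u.length = w.length := le_antisymm (D.length_le_of_top top) (D.length_le_of_bot bot)
  have hD := D.partner_eq_idp len top
  refine Or.inr (Or.inr ⟨?_, hD⟩)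
  -- A vertical string joins the `i`-th letters of the two words; the dualization of the upper word
  -- and the opposite letters at its ends cancel.
  apply List.ext_getElem?
  intro i
  by_cases hi : i < u.length
  · have := D.planar.orient (u.length - 1 - i)
    rw [hD, idp, if_pos (by omega)] at this
    simp only [bdry] at this
    rw [List.getElem?_append_right (by simp; omega), List.getElem?_append_left (by simp; omega),
      List.getElem?_reverse (by simp; omega)] at this
    simp only [List.length_reverse, List.length_map, List.getElem?_map] at this
    rw [show 2 * u.length - 1 - (u.length - 1 - i) - u.length = i by omega,
      show u.length - 1 - (u.length - 1 - i) = i by omega] at this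
    rw [this]
    cases u[i]? <;> simp
  · rw [List.getElem?_eq_none (by omega), List.getElem?_eq_none (by omega)]

theorem eq_id_or_top {w : List Bool} (D : Diagram w w) :
    (∃ x, x + 1 < w.length ∧ D.partner x = x + 1) ∨ D = id w :=
  D.top_or.imp_right fun h => Diagram.ext (D.partner_eq_idp rfl h)

theorem eq_id_or_bot {w : List Bool} (D : Diagram w w) :
    (∃ x, x + 1 < w.length ∧
      D.partner (w.length + (w.length - 2 - x)) = w.length + (w.length - 1 - x)) ∨ D = id w := by
  refine D.bot_or.imp_right fun bot => Diagram.ext (D.partner_eq_idp rfl fun x hx => ?_)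
  refine ⟨?_, D.good.lt (by omega)⟩
  -- The lower points inject into equally many upper points, so every upper point is reached.
  have h : (Finset.Ico w.length (w.length + w.length)).image D.partner = Finset.range w.length := by
    apply Finset.eq_of_subset_of_card_le
    · intro y hy
      obtain ⟨z, hz, rfl⟩ := Finset.mem_image.1 hy
      rw [Finset.mem_Ico] at hz
      exact Finset.mem_range.2 (bot z hz.1 hz.2)
    · rw [Finset.card_image_of_injective _ D.partner_injective]
      simp
  obtain ⟨z, hz, rfl⟩ := Finset.mem_image.1 (h ▸ Finset.mem_range.2 hx)
  rw [D.good.invol]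
  exact (Finset.mem_Ico.1 hz).1

/-- If `D` is not the identity, it has an upper arc, and that arc would survive in the composite. -/
theorem comp_eq_id {w : List Bool} {D E : Diagram w w} (h : D.comp E = id w) :
    D = id w ∧ E = id w := by
  rcases D.eq_id_or_top with ⟨x, hx, hD⟩ | rfl
  · have := D.comp_top E (x := x) (by omega) (by omega)
    rw [h, hD] at this
    simp only [id, idp] at this
    split_ifs at this <;> omega
  · exact ⟨rfl, by rw [← h, E.id_comp.1]⟩

theorem tensor_injective {u u' v v' : List Bool} {D D' : Diagram u u'} {E E' : Diagram v v'}
    (h : D.tensor E = D'.tensor E') : D = D' ∧ E = E' := by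
  have h := congrArg partner h
  simp only [tensor] at h
  constructor
  · apply Diagram.ext
    funext x
    by_cases c : x < u.length + u'.length
    · have := congrFun h (v.length + x)
      rw [ins_mid _ _ c, ins_mid _ _ c] at this
      omega
    · rw [D.good.out x (by omega), D'.good.out x (by omega)]
  · apply Diagram.ext
    funext x
    have := congrFun h (shift v.length (u.length + u'.length) x)
    rw [ins_shift, ins_shift] at this
    simp only [shift] at this
    split_ifs at this <;> omega

theorem ext_lt {u v : List Bool} {D E : Diagram u v}
    (h : ∀ x, x < u.length + v.length → D.partner x = E.partner x) : D = E := by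
  apply Diagram.ext
  funext x
  by_cases c : x < u.length + v.length
  · exact h x c
  · rw [D.good.out x (by omega), E.good.out x (by omega)]

/-! ### Temperley-Lieb relations for a cap followed by a cup -/

/-- A cap followed by a cup. -/
def arcs (a : Bool) : Diagram [a, !a] [a, !a] := (cap a).comp (cup a)

theorem cap_cup_numLoops (a : Bool) : (cap a).numLoops (cup a) = 0 := rfl

theorem arcs_comp (a : Bool) : (arcs a).comp (arcs a) = arcs a ∧ (arcs a).numLoops (arcs a) = 1 := by
  refine ⟨ext_lt ?_, ?_⟩ <;> cases a <;> decide +kernel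

/-- The relation `e₁ e₂ e₁ = e₁` on three alternating strings, without loops. By `ext_lt` it
concerns finitely many points and can be decided. -/
theorem arcs_zigzag (a : Bool) :
    (((arcs a).tensor (id [!!a])).comp ((id [a]).tensor (arcs (!a)))).comp
      ((arcs a).tensor (id [!!a])) = (arcs a).tensor (id [!!a]) ∧
    ((arcs a).tensor (id [!!a])).numLoops ((id [a]).tensor (arcs (!a))) = 0 ∧
    (((arcs a).tensor (id [!!a])).comp ((id [a]).tensor (arcs (!a)))).numLoops
      ((arcs a).tensor (id [!!a])) = 0 := by
  refine ⟨ext_lt ?_, ?_, ?_⟩ <;> cases a <;> decide +kernel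

theorem arcs_tensor_id (a : Bool) (v : List Bool) (h : Opp (a :: (!a) :: v) v.length) :
    (arcs a).tensor (id v) = turn (a :: (!a) :: v) v.length h := by
  have e : ∀ x, x < 4 → (arcs a).partner x = turnp 2 0 x := by
    intro x hx
    interval_cases x <;> rfl
  apply ext_lt
  intro x hx
  have hN := h.1
  simp only [List.length_cons] at hN
  simp only [tensor, turn, id, List.length_cons, List.length_nil]
  obtain ⟨y, rfl⟩ | ⟨y, hy, rfl⟩ := shift_or v.length (2 + 2) x
  · rw [ins_shift]
    have := turnp_cases hN (shift v.length (2 + 2) y)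
    simp only [shift, idp] at *
    split_ifs at * <;> omega
  · rw [ins_mid _ _ hy, e y hy]
    have := turnp_cases hN (v.length + y)
    have := turnp_cases (show 0 + 1 < 2 by omega) y
    omega

end Diagram
open Diagram

noncomputable section

/-! ### Linear combinations of diagrams -/

section Hom

variable {d : ℂ} {u u' u'' v v' v'' w w' : List Bool}

theorem hom_induction {motive : ((⟨u⟩ : KCat d) ⟶ ⟨v⟩) → Prop} (f : (⟨u⟩ : KCat d) ⟶ ⟨v⟩)
    (zero : motive 0) (add : ∀ f g, motive f → motive g → motive (f + g))
    (smul : ∀ (c : ℂ) (D : Diagram u v), motive (c • ofDiagram d D)) : motive f := by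
  refine Finsupp.induction_linear (motive := motive) f zero add fun D c => ?_
  have : (Finsupp.single D c : Diagram u v →₀ ℂ) = c • Finsupp.single D 1 := by simp
  rw [this]
  exact smul c D

theorem ofDiagram_comp (D : Diagram u v) (E : Diagram v w) :
    ofDiagram d D ≫ ofDiagram d E = d ^ D.numLoops E • ofDiagram d (D.comp E) := by
  refine (compHom_single d D E 1 1).trans ?_
  change _ = d ^ D.numLoops E • (Finsupp.single (D.comp E) 1 : Diagram u w →₀ ℂ)
  simp

theorem ofDiagram_id (w : List Bool) : ofDiagram d (Diagram.id w) = 𝟙 (⟨w⟩ : KCat d) := rfl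

/-- `tensorHom` as a bilinear map. -/
def tensorLin (d : ℂ) (u u' v v' : List Bool) :
    ((⟨u⟩ : KCat d) ⟶ ⟨u'⟩) →ₗ[ℂ] ((⟨v⟩ : KCat d) ⟶ ⟨v'⟩) →ₗ[ℂ]
      ((⟨u ++ v⟩ : KCat d) ⟶ ⟨u' ++ v'⟩) :=
  Finsupp.linearCombination ℂ (fun D : Diagram u u' =>
    Finsupp.linearCombination ℂ (fun E : Diagram v v' =>
      (Finsupp.single (D.tensor E) 1 : Diagram (u ++ v) (u' ++ v') →₀ ℂ)))

theorem tensorHom_eq (f : (⟨u⟩ : KCat d) ⟶ ⟨u'⟩) (g : (⟨v⟩ : KCat d) ⟶ ⟨v'⟩) :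
    tensorHom f g = tensorLin d u u' v v' f g := rfl

theorem tensorHom_ofDiagram (D : Diagram u u') (E : Diagram v v') :
    tensorHom (ofDiagram d D) (ofDiagram d E) = ofDiagram d (D.tensor E) := by
  simp [tensorHom, ofDiagram]

theorem tensorHom_add (f : (⟨u⟩ : KCat d) ⟶ ⟨u'⟩) (g h : (⟨v⟩ : KCat d) ⟶ ⟨v'⟩) :
    tensorHom f (g + h) = tensorHom f g + tensorHom f h := by simp [tensorHom_eq]
theorem tensorHom_sub (f : (⟨u⟩ : KCat d) ⟶ ⟨u'⟩) (g h : (⟨v⟩ : KCat d) ⟶ ⟨v'⟩) :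
    tensorHom f (g - h) = tensorHom f g - tensorHom f h := by simp [tensorHom_eq]
theorem tensorHom_smul (f : (⟨u⟩ : KCat d) ⟶ ⟨u'⟩) (c : ℂ) (g : (⟨v⟩ : KCat d) ⟶ ⟨v'⟩) :
    tensorHom f (c • g) = c • tensorHom f g := by simp [tensorHom_eq]
theorem tensorHom_zero (f : (⟨u⟩ : KCat d) ⟶ ⟨u'⟩) :
    tensorHom f (0 : (⟨v⟩ : KCat d) ⟶ ⟨v'⟩) = 0 := by simp [tensorHom_eq]
theorem add_tensorHom (f h : (⟨u⟩ : KCat d) ⟶ ⟨u'⟩) (g : (⟨v⟩ : KCat d) ⟶ ⟨v'⟩) :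
    tensorHom (f + h) g = tensorHom f g + tensorHom h g := by simp [tensorHom_eq]
theorem smul_tensorHom (c : ℂ) (f : (⟨u⟩ : KCat d) ⟶ ⟨u'⟩) (g : (⟨v⟩ : KCat d) ⟶ ⟨v'⟩) :
    tensorHom (c • f) g = c • tensorHom f g := by simp [tensorHom_eq]
theorem zero_tensorHom (g : (⟨v⟩ : KCat d) ⟶ ⟨v'⟩) :
    tensorHom (0 : (⟨u⟩ : KCat d) ⟶ ⟨u'⟩) g = 0 := by simp [tensorHom_eq]

theorem tensorHom_comp (f : (⟨u⟩ : KCat d) ⟶ ⟨u'⟩) (f' : (⟨u'⟩ : KCat d) ⟶ ⟨u''⟩)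
    (g : (⟨v⟩ : KCat d) ⟶ ⟨v'⟩) (g' : (⟨v'⟩ : KCat d) ⟶ ⟨v''⟩) :
    tensorHom f g ≫ tensorHom f' g' = tensorHom (f ≫ f') (g ≫ g') := by
  induction f using hom_induction with
  | zero => simp [zero_tensorHom]
  | add f₁ f₂ h₁ h₂ => simp only [add_tensorHom, Preadditive.add_comp, h₁, h₂]
  | smul a D =>
  induction f' using hom_induction with
  | zero => simp [zero_tensorHom]
  | add f₁ f₂ h₁ h₂ => simp only [add_tensorHom, Preadditive.comp_add, h₁, h₂]
  | smul a' D' =>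
  induction g using hom_induction with
  | zero => simp [tensorHom_zero]
  | add f₁ f₂ h₁ h₂ => simp only [tensorHom_add, Preadditive.add_comp, h₁, h₂]
  | smul b E =>
  induction g' using hom_induction with
  | zero => simp [tensorHom_zero]
  | add f₁ f₂ h₁ h₂ => simp only [tensorHom_add, Preadditive.comp_add, h₁, h₂]
  | smul b' E' =>
    obtain ⟨h1, h2⟩ := comp_tensor D D' E E'
    simp only [smul_tensorHom, tensorHom_smul, Linear.smul_comp, Linear.comp_smul,
      tensorHom_ofDiagram, ofDiagram_comp, h1, h2, smul_smul, pow_add]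
    congr 1
    ring

theorem tensorHom_id (u v : List Bool) :
    tensorHom (𝟙 (⟨u⟩ : KCat d)) (𝟙 (⟨v⟩ : KCat d)) = 𝟙 (⟨u ++ v⟩ : KCat d) := by
  rw [← ofDiagram_id, ← ofDiagram_id, tensorHom_ofDiagram, id_tensor_id, ofDiagram_id]

/-- Forget the words of a linear combination of diagrams. -/
def pairings (f : (⟨u⟩ : KCat d) ⟶ ⟨v⟩) : (ℕ → ℕ) →₀ ℂ :=
  Finsupp.mapDomain (M := ℂ) (Diagram.partner (w := u) (w' := v)) f

theorem pairings_injective : Function.Injective (pairings (d := d) (u := u) (v := v)) :=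
  Finsupp.mapDomain_injective fun _ _ h => Diagram.ext h

theorem pairings_add (f g : (⟨u⟩ : KCat d) ⟶ ⟨v⟩) : pairings (f + g) = pairings f + pairings g :=
  Finsupp.mapDomain_add
theorem pairings_smul (c : ℂ) (f : (⟨u⟩ : KCat d) ⟶ ⟨v⟩) : pairings (c • f) = c • pairings f :=
  Finsupp.mapDomain_smul c _
theorem pairings_ofDiagram (D : Diagram u v) :
    pairings (ofDiagram d D) = Finsupp.single D.partner 1 :=
  Finsupp.mapDomain_single

/-- The two triple products live in different types. Comparing bare pairings avoids any transport;
for the concrete words used later the types agree by definition, and `pairings_injective` gives an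
honest equality. -/
theorem pairings_tensor_assoc (f : (⟨u⟩ : KCat d) ⟶ ⟨u'⟩) (g : (⟨v⟩ : KCat d) ⟶ ⟨v'⟩)
    (h : (⟨w⟩ : KCat d) ⟶ ⟨w'⟩) :
    pairings (tensorHom (tensorHom f g) h) = pairings (tensorHom f (tensorHom g h)) := by
  induction f using hom_induction with
  | zero => simp only [zero_tensorHom]; rfl
  | add f₁ f₂ h₁ h₂ => simp only [add_tensorHom, pairings_add, h₁, h₂]
  | smul a D =>
  induction g using hom_induction with
  | zero => simp only [zero_tensorHom, tensorHom_zero]; rfl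
  | add f₁ f₂ h₁ h₂ => simp only [add_tensorHom, tensorHom_add, pairings_add, h₁, h₂]
  | smul b E =>
  induction h using hom_induction with
  | zero => simp only [tensorHom_zero]; rfl
  | add f₁ f₂ h₁ h₂ => simp only [tensorHom_add, pairings_add, h₁, h₂]
  | smul c F =>
    simp only [smul_tensorHom, tensorHom_smul, tensorHom_ofDiagram, pairings_smul,
      pairings_ofDiagram, Diagram.tensor_assoc]

/-! ### The coefficient of the identity -/

/-- The coefficient of a diagram. -/
def coeff (D : Diagram u v) (f : (⟨u⟩ : KCat d) ⟶ ⟨v⟩) : ℂ :=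
  (show Diagram u v →₀ ℂ from f) D

variable (D : Diagram u v)
theorem coeff_add (f g : (⟨u⟩ : KCat d) ⟶ ⟨v⟩) : coeff D (f + g) = coeff D f + coeff D g := rfl
theorem coeff_sub (f g : (⟨u⟩ : KCat d) ⟶ ⟨v⟩) : coeff D (f - g) = coeff D f - coeff D g := rfl
theorem coeff_zero : coeff D (0 : (⟨u⟩ : KCat d) ⟶ ⟨v⟩) = 0 := rfl
theorem coeff_smul (c : ℂ) (f : (⟨u⟩ : KCat d) ⟶ ⟨v⟩) : coeff D (c • f) = c * coeff D f := rfl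
open Classical in
theorem coeff_ofDiagram (E : Diagram u v) : coeff D (ofDiagram d E) = if E = D then 1 else 0 :=
  Finsupp.single_apply

/-- By `comp_eq_id` the nonidentity diagrams span a two-sided ideal, and this is the character of
the quotient. -/
theorem coeff_id_comp (f g : (⟨w⟩ : KCat d) ⟶ ⟨w⟩) :
    coeff (Diagram.id w) (f ≫ g) = coeff (Diagram.id w) f * coeff (Diagram.id w) g := by
  induction f using hom_induction with
  | zero => simp [coeff_zero]
  | add f₁ f₂ h₁ h₂ => simp only [coeff_add, Preadditive.add_comp, h₁, h₂, add_mul]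
  | smul a D =>
  induction g using hom_induction with
  | zero => simp [coeff_zero]
  | add f₁ f₂ h₁ h₂ => simp only [coeff_add, Preadditive.comp_add, h₁, h₂, mul_add]
  | smul b E =>
    simp only [Linear.smul_comp, Linear.comp_smul, ofDiagram_comp, coeff_smul, coeff_ofDiagram]
    by_cases h : D.comp E = Diagram.id w
    · obtain ⟨rfl, rfl⟩ := comp_eq_id h
      simp [(Diagram.id w).id_comp]
      ring
    · rw [if_neg h]
      split_ifs with h1 h2
      · exact absurd (by rw [h1, h2, (Diagram.id w).id_comp.1]) h
      all_goals simp

theorem coeff_id_tensor (f : (⟨u⟩ : KCat d) ⟶ ⟨u⟩) (g : (⟨v⟩ : KCat d) ⟶ ⟨v⟩) :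
    coeff (Diagram.id (u ++ v)) (tensorHom f g) =
      coeff (Diagram.id u) f * coeff (Diagram.id v) g := by
  induction f using hom_induction with
  | zero => simp [coeff_zero, zero_tensorHom]
  | add f₁ f₂ h₁ h₂ => simp only [coeff_add, add_tensorHom, h₁, h₂, add_mul]
  | smul a D =>
  induction g using hom_induction with
  | zero => simp [coeff_zero, tensorHom_zero]
  | add f₁ f₂ h₁ h₂ => simp only [coeff_add, tensorHom_add, h₁, h₂, mul_add]
  | smul b E =>
    simp only [tensorHom_smul, smul_tensorHom, tensorHom_ofDiagram, coeff_smul, coeff_ofDiagram,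
      ← id_tensor_id]
    by_cases h : D.tensor E = (Diagram.id u).tensor (Diagram.id v)
    · obtain ⟨rfl, rfl⟩ := tensor_injective h
      simp
      ring
    · rw [if_neg h]
      split_ifs with h1 h2
      · exact absurd (by rw [h1, h2]) h
      all_goals simp

theorem coeff_id_id (w : List Bool) : coeff (Diagram.id w) (𝟙 (⟨w⟩ : KCat d)) = 1 := by
  rw [← ofDiagram_id, coeff_ofDiagram, if_pos rfl]

/-! ### Morphisms killed by caps and cups -/

/-- `P` is killed by composition with arcs between neighbours, on both sides. -/
structure Kills (P : (⟨w⟩ : KCat d) ⟶ ⟨w⟩) : Prop where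
  right : ∀ x h, P ≫ ofDiagram d (turn w x h) = 0
  left : ∀ x h, ofDiagram d (turn w x h) ≫ P = 0

/-- Composing with the turn reproduces `D` up to a power of `d`. As `d` is invertible, the number of
loops does not matter. -/
theorem ofDiagram_top (hd : d ≠ 0) (D : Diagram u v) {x : ℕ} (hx : x + 1 < u.length)
    (h : D.partner x = x + 1) : ∃ (c : ℂ) (h : Opp u x),
    ofDiagram d D = c • (ofDiagram d (turn u x h) ≫ ofDiagram d D) := by
  refine ⟨(d ^ (turn u x (D.opp_of_top hx h)).numLoops D)⁻¹, D.opp_of_top hx h, ?_⟩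
  rw [ofDiagram_comp, turn_comp D _ h, inv_smul_smul₀ (pow_ne_zero _ hd)]

theorem ofDiagram_bot (hd : d ≠ 0) (D : Diagram u v) {x : ℕ} (hx : x + 1 < v.length)
    (h : D.partner (u.length + (v.length - 2 - x)) = u.length + (v.length - 1 - x)) :
    ∃ (c : ℂ) (h : Opp v x),
    ofDiagram d D = c • (ofDiagram d D ≫ ofDiagram d (turn v x h)) := by
  refine ⟨(d ^ D.numLoops (turn v x (D.opp_of_bot hx h)))⁻¹, D.opp_of_bot hx h, ?_⟩
  rw [ofDiagram_comp, comp_turn D _ h, inv_smul_smul₀ (pow_ne_zero _ hd)]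

/-- An upper arc of `D` splits off a turn that `P` kills, and a lower arc splits off one that `Q`
kills. -/
theorem Kills.sandwich (hd : d ≠ 0) {P : (⟨u⟩ : KCat d) ⟶ ⟨u⟩} {Q : (⟨v⟩ : KCat d) ⟶ ⟨v⟩}
    (hP : Kills P) (hQ : Kills Q) (D : Diagram u v) :
    P ≫ ofDiagram d D ≫ Q = 0 ∨ u = v ∧ D.partner = idp u.length := by
  rcases D.trichotomy with ⟨x, hx, h⟩ | ⟨x, hx, h⟩ | h
  · obtain ⟨c, h', e⟩ := ofDiagram_top hd D hx h
    left
    rw [e, Linear.smul_comp, Linear.comp_smul, Category.assoc, reassoc_of% (hP.right x h')]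
    simp
  · obtain ⟨c, h', e⟩ := ofDiagram_bot hd D hx h
    left
    rw [e, Linear.smul_comp, Category.assoc, hQ.left x h']
    simp
  · exact Or.inr h

theorem Kills.sandwich_of_ne (hd : d ≠ 0) {P : (⟨u⟩ : KCat d) ⟶ ⟨u⟩}
    {Q : (⟨v⟩ : KCat d) ⟶ ⟨v⟩} (hP : Kills P) (hQ : Kills Q) (huv : u ≠ v)
    (f : (⟨u⟩ : KCat d) ⟶ ⟨v⟩) : P ≫ f ≫ Q = 0 := by
  induction f using hom_induction with
  | zero => simp
  | add f g hf hg => rw [Preadditive.add_comp, Preadditive.comp_add, hf, hg, add_zero]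
  | smul c D =>
    rw [Linear.smul_comp, Linear.comp_smul,
      (hP.sandwich hd hQ D).resolve_right fun h => huv h.1, smul_zero]

theorem Kills.sandwich_self (hd : d ≠ 0) {P Q : (⟨u⟩ : KCat d) ⟶ ⟨u⟩} (hP : Kills P)
    (hQ : Kills Q) (f : (⟨u⟩ : KCat d) ⟶ ⟨u⟩) : ∃ c : ℂ, P ≫ f ≫ Q = c • (P ≫ Q) := by
  induction f using hom_induction with
  | zero => exact ⟨0, by simp⟩
  | add f g hf hg =>
    obtain ⟨a, ha⟩ := hf
    obtain ⟨b, hb⟩ := hg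
    exact ⟨a + b, by rw [Preadditive.add_comp, Preadditive.comp_add, ha, hb, add_smul]⟩
  | smul c D =>
    rw [Linear.smul_comp, Linear.comp_smul]
    rcases hP.sandwich hd hQ D with h | h
    · exact ⟨0, by rw [h]; simp⟩
    · obtain rfl : D = Diagram.id u := Diagram.ext h.2
      exact ⟨c, by rw [ofDiagram_id, Category.id_comp]⟩

theorem not_opp_border {u v : List Bool} {x : ℕ} (h : Opp (u ++ v) x) (hx : x + 1 = v.length)
    (hb : ∀ b, v.head? = some b → u.getLast? = some b) : False := by
  obtain ⟨-, h⟩ := h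
  match v, hx, hb with
  | b :: v, hx, hb =>
    obtain ⟨u, rfl⟩ := List.getLast?_eq_some_iff.1 (hb b rfl)
    obtain rfl : x = v.length := by simpa using hx
    simp at h

/-- A turn on `u ++ v` lies in one of the factors, since the equal letters at the border exclude an
oriented arc there. -/
theorem Kills.tensor {P : (⟨u⟩ : KCat d) ⟶ ⟨u⟩} {Q : (⟨v⟩ : KCat d) ⟶ ⟨v⟩}
    (hP : Kills P) (hQ : Kills Q) (hb : ∀ b, v.head? = some b → u.getLast? = some b) :
    Kills (tensorHom P Q) := by
  have key : ∀ x (h : Opp (u ++ v) x), (∃ x h', ofDiagram d (turn (u ++ v) _ h) =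
      tensorHom (ofDiagram d (turn u x h')) (𝟙 _)) ∨ ∃ x h', ofDiagram d (turn (u ++ v) _ h) =
      tensorHom (𝟙 _) (ofDiagram d (turn v x h')) := by
    intro x h
    rcases lt_trichotomy (x + 1) v.length with c | c | c
    · refine Or.inr ⟨x, opp_append_right h c, ?_⟩
      rw [← ofDiagram_id, tensorHom_ofDiagram, id_tensor_turn h c]
    · exact (not_opp_border h c hb).elim
    · refine Or.inl ⟨x - v.length, opp_append_left h (by omega), ?_⟩
      rw [← ofDiagram_id, tensorHom_ofDiagram, turn_tensor_id h (by omega)]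
  constructor <;> intro x h
  · rcases key x h with ⟨y, h', e⟩ | ⟨y, h', e⟩
    · rw [e, tensorHom_comp, hP.right, zero_tensorHom]
    · rw [e, tensorHom_comp, hQ.right, tensorHom_zero]
  · rcases key x h with ⟨y, h', e⟩ | ⟨y, h', e⟩
    · rw [e, tensorHom_comp, hP.left, zero_tensorHom]
    · rw [e, tensorHom_comp, hQ.left, tensorHom_zero]

end Hom

/-! ### Jones-Wenzl idempotents -/

section Abstract

variable {C : Type*} [Category* C] [Preadditive C] [Linear ℂ C] {X : C} {g e h : X ⟶ X} {c δ : ℂ}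

/-- One step of the recursion for Jones-Wenzl idempotents. -/
theorem wenzl_step (hg : g ≫ g = g) (he : e ≫ g ≫ e = δ • (e ≫ h)) (eh : e ≫ h = h ≫ e)
    (hl : h ≫ g = g) (hr : g ≫ h = g) (hc : c * δ = 1) :
    (g - c • (g ≫ e ≫ g)) ≫ (g - c • (g ≫ e ≫ g)) = g - c • (g ≫ e ≫ g) ∧
    e ≫ (g - c • (g ≫ e ≫ g)) = 0 ∧ (g - c • (g ≫ e ≫ g)) ≫ e = 0 := by
  -- In `he`, composed with `g`, the factor `h` is absorbed; `c * δ = 1` then makes the two terms of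
  -- `h3` cancel.
  have h1 : e ≫ g ≫ e ≫ g = δ • (e ≫ g) := by
    have := congrArg (· ≫ g) he
    simpa [hl] using this
  have h2 : g ≫ e ≫ g ≫ e = δ • (g ≫ e) := by
    rw [he, eh, Linear.comp_smul, reassoc_of% hr]
  have h3 : e ≫ (g - c • (g ≫ e ≫ g)) = 0 := by
    rw [Preadditive.comp_sub, Linear.comp_smul, h1, smul_smul, hc, one_smul, sub_self]
  have h4 : (g - c • (g ≫ e ≫ g)) ≫ e = 0 := by
    rw [Preadditive.sub_comp, Linear.smul_comp, Category.assoc, Category.assoc, h2, smul_smul, hc,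
      one_smul, sub_self]
  have h5 : g ≫ (g - c • (g ≫ e ≫ g)) = g - c • (g ≫ e ≫ g) := by
    rw [Preadditive.comp_sub, Linear.comp_smul, reassoc_of% hg, hg]
  refine ⟨?_, h3, h4⟩
  conv_lhs => rw [Preadditive.sub_comp, Linear.smul_comp, Category.assoc, Category.assoc, h5, h3]
  simp

end Abstract

/-! ### Vertical strings beside Jones-Wenzl idempotents -/

variable (d : ℂ)

variable {d} in
/-- A vertical string to the left of an endomorphism of an alternating word. -/
def string (a : Bool) (n : ℕ) (f : (⟨alt (!a) n⟩ : KCat d) ⟶ ⟨alt (!a) n⟩) :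
    (⟨alt a (n + 1)⟩ : KCat d) ⟶ ⟨alt a (n + 1)⟩ :=
  tensorHom (𝟙 (⟨[a]⟩ : KCat d)) f

/-- A vertical string to the left of a Jones-Wenzl idempotent. -/
def stringJW (a : Bool) (n : ℕ) : (⟨alt a (n + 1)⟩ : KCat d) ⟶ ⟨alt a (n + 1)⟩ :=
  string a n (jonesWenzl d (!a) n)

/-- Two vertical strings to the left of a Jones-Wenzl idempotent. -/
def stringsJW (a : Bool) (n : ℕ) : (⟨alt a (n + 2)⟩ : KCat d) ⟶ ⟨alt a (n + 2)⟩ :=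
  tensorHom (𝟙 (⟨[a, !a]⟩ : KCat d)) (jonesWenzl d (!!a) n)

/-- A cap followed by a cup, to the left of vertical strings. -/
def capCup (a : Bool) (n : ℕ) : (⟨alt a (n + 2)⟩ : KCat d) ⟶ ⟨alt a (n + 2)⟩ :=
  tensorHom (ofDiagram d (arcs a)) (𝟙 (⟨alt (!!a) n⟩ : KCat d))

theorem ofDiagram_arcs (a : Bool) :
    ofDiagram d (cap a) ≫ ofDiagram d (cup a) = ofDiagram d (arcs a) := by
  rw [ofDiagram_comp, cap_cup_numLoops, pow_zero, one_smul, arcs]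

theorem jonesWenzl_add_two (a : Bool) (n : ℕ) : jonesWenzl d a (n + 2) =
    stringJW d a (n + 1) - (qint d (n + 1) / qint d (n + 2)) •
      (stringJW d a (n + 1) ≫ capCup d a n ≫ stringJW d a (n + 1)) := by
  rw [capCup, ← ofDiagram_arcs]
  rfl

variable {d}

section String

variable (a : Bool) (n : ℕ) (f g : (⟨alt (!a) n⟩ : KCat d) ⟶ ⟨alt (!a) n⟩)

theorem string_comp : string a n f ≫ string a n g = string a n (f ≫ g) := by
  refine (tensorHom_comp _ _ _ _).trans ?_
  rw [Category.comp_id]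
  rfl

theorem string_add : string a n (f + g) = string a n f + string a n g := tensorHom_add _ _ _
theorem string_sub : string a n (f - g) = string a n f - string a n g := tensorHom_sub _ _ _
theorem string_smul (c : ℂ) : string a n (c • f) = c • string a n f := tensorHom_smul _ _ _
theorem string_zero : string a n (0 : (⟨alt (!a) n⟩ : KCat d) ⟶ ⟨alt (!a) n⟩) = 0 :=
  tensorHom_zero _

theorem string_id : string a n (𝟙 (⟨alt (!a) n⟩ : KCat d)) = 𝟙 _ := tensorHom_id _ _

/-- A vertical string to the left of a diagram. -/
def stringDiagram (D : Diagram (alt (!a) n) (alt (!a) n)) :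
    Diagram (alt a (n + 1)) (alt a (n + 1)) := (Diagram.id [a]).tensor D

theorem string_ofDiagram (D : Diagram (alt (!a) n) (alt (!a) n)) :
    string a n (ofDiagram d D) = ofDiagram d (stringDiagram a n D) := tensorHom_ofDiagram _ _

end String

theorem arcs_comp_arcs (a : Bool) :
    ofDiagram d (arcs a) ≫ ofDiagram d (arcs a) = d • ofDiagram d (arcs a) := by
  rw [ofDiagram_comp, (arcs_comp a).1, (arcs_comp a).2, pow_one]

theorem capCup_comp (a : Bool) (n : ℕ) : capCup d a n ≫ capCup d a n = d • capCup d a n := by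
  refine (tensorHom_comp _ _ _ _).trans ?_
  rw [arcs_comp_arcs, Category.comp_id, smul_tensorHom]
  rfl

theorem capCup_comp_stringsJW (a : Bool) (n : ℕ) :
    capCup d a n ≫ stringsJW d a n = stringsJW d a n ≫ capCup d a n := by
  refine (tensorHom_comp _ _ _ _).trans (Eq.trans ?_ (tensorHom_comp _ _ _ _).symm)
  rw [Category.comp_id, Category.comp_id, Category.id_comp, Category.id_comp]

theorem stringJW_zero (a : Bool) : stringJW d a 0 = 𝟙 _ := tensorHom_id [a] []

theorem stringJW_one (a : Bool) : stringJW d a 1 = 𝟙 _ := tensorHom_id [a] [!a]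

theorem stringsJW_zero (a : Bool) : stringsJW d a 0 = 𝟙 _ := tensorHom_id [a, !a] []

/-- Associativity of juxtaposition: two strings can be added at once or one after the other. The
words on both sides agree by definition. -/
theorem stringsJW_eq (a : Bool) (n : ℕ) :
    stringsJW d a n = string a (n + 1) (stringJW d (!a) n) := by
  refine Eq.trans ?_ (pairings_injective (pairings_tensor_assoc (𝟙 (⟨[a]⟩ : KCat d))
    (𝟙 (⟨[!a]⟩ : KCat d)) (jonesWenzl d (!!a) n)))
  rw [tensorHom_id]
  rfl

/-- `arcs_zigzag` on the first three strings, juxtaposed with the identity on the others. -/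
theorem capCup_zigzag (a : Bool) (n : ℕ) :
    capCup d a (n + 1) ≫ string a (n + 2) (capCup d (!a) n) ≫ capCup d a (n + 1) = capCup d a (n + 1) := by
  have h1 : capCup d a (n + 1) = tensorHom (ofDiagram d ((arcs a).tensor (Diagram.id [!!a])))
      (𝟙 (⟨alt (!!!a) n⟩ : KCat d)) := by
    rw [← tensorHom_ofDiagram]
    refine Eq.trans ?_ (pairings_injective (pairings_tensor_assoc (ofDiagram d (arcs a))
      (ofDiagram d (Diagram.id [!!a])) (𝟙 (⟨alt (!!!a) n⟩ : KCat d)))).symm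
    rw [ofDiagram_id, tensorHom_id]
    rfl
  have h2 : string a (n + 2) (capCup d (!a) n) =
      tensorHom (ofDiagram d ((Diagram.id [a]).tensor (arcs (!a))))
        (𝟙 (⟨alt (!!!a) n⟩ : KCat d)) := by
    rw [← tensorHom_ofDiagram]
    exact (pairings_injective (pairings_tensor_assoc (ofDiagram d (Diagram.id [a]))
      (ofDiagram d (arcs (!a))) (𝟙 (⟨alt (!!!a) n⟩ : KCat d)))).symm
  obtain ⟨z1, z2, z3⟩ := arcs_zigzag a
  have h3 : ofDiagram d ((arcs a).tensor (Diagram.id [!!a])) ≫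
      ofDiagram d ((Diagram.id [a]).tensor (arcs (!a))) ≫
      ofDiagram d ((arcs a).tensor (Diagram.id [!!a])) =
      ofDiagram d ((arcs a).tensor (Diagram.id [!!a])) := by
    rw [← Category.assoc, ofDiagram_comp, z2, pow_zero, one_smul, ofDiagram_comp, z3, pow_zero,
      one_smul, z1]
  rw [h2, h1]
  refine (congrArg (_ ≫ ·) (tensorHom_comp _ _ _ _)).trans ((tensorHom_comp _ _ _ _).trans ?_)
  rw [Category.comp_id, Category.comp_id]
  exact congrArg (tensorHom · _) h3

theorem stringJW_idem {a : Bool} {n : ℕ}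
    (h : jonesWenzl d (!a) n ≫ jonesWenzl d (!a) n = jonesWenzl d (!a) n) :
    stringJW d a n ≫ stringJW d a n = stringJW d a n := by
  rw [stringJW, string_comp, h]

theorem stringsJW_idem {a : Bool} {n : ℕ}
    (h : jonesWenzl d (!!a) n ≫ jonesWenzl d (!!a) n = jonesWenzl d (!!a) n) :
    stringsJW d a n ≫ stringsJW d a n = stringsJW d a n := by
  refine (tensorHom_comp _ _ _ _).trans ?_
  rw [Category.comp_id, h]
  rfl

/-- Each term of the recursive formula begins and ends with the idempotent `stringJW d a n`. -/
theorem stringJW_absorb {a : Bool} {n : ℕ}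
    (h : jonesWenzl d (!a) n ≫ jonesWenzl d (!a) n = jonesWenzl d (!a) n) :
    stringJW d a n ≫ jonesWenzl d a (n + 1) = jonesWenzl d a (n + 1) ∧
    jonesWenzl d a (n + 1) ≫ stringJW d a n = jonesWenzl d a (n + 1) := by
  cases n with
  | zero => rw [stringJW_zero]; exact ⟨Category.id_comp _, Category.comp_id _⟩
  | succ n =>
    have hg := stringJW_idem h
    rw [jonesWenzl_add_two]
    constructor
    · rw [Preadditive.comp_sub, Linear.comp_smul, reassoc_of% hg, hg]
    · rw [Preadditive.sub_comp, Linear.smul_comp, Category.assoc, Category.assoc, hg]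

theorem strings_absorb {a : Bool} {n : ℕ}
    (h : jonesWenzl d (!!a) n ≫ jonesWenzl d (!!a) n = jonesWenzl d (!!a) n) :
    stringsJW d a n ≫ stringJW d a (n + 1) = stringJW d a (n + 1) ∧
    stringJW d a (n + 1) ≫ stringsJW d a n = stringJW d a (n + 1) := by
  obtain ⟨h1, h2⟩ := stringJW_absorb h
  rw [stringsJW_eq, stringJW.eq_1 d a (n + 1), string_comp, string_comp, h1, h2]
  exact ⟨rfl, rfl⟩

/-- The partial trace of a Jones-Wenzl idempotent. -/
theorem capCup_string_capCup {n : ℕ} (a : Bool)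
    (h : ∀ a, jonesWenzl d a n ≫ jonesWenzl d a n = jonesWenzl d a n) (hq : qint d (n + 1) ≠ 0) :
    capCup d a n ≫ stringJW d a (n + 1) ≫ capCup d a n =
      (qint d (n + 2) / qint d (n + 1)) • (capCup d a n ≫ stringsJW d a n) := by
  cases n with
  | zero =>
    -- On two strings the formula is the loop value, as `[2] / [1] = d`.
    rw [stringJW_one, stringsJW_zero, Category.id_comp, capCup_comp, Category.comp_id]
    simp [qint]
  | succ n =>
    have hH := stringsJW_idem (h (!!a))
    have hc := capCup_comp_stringsJW (d := d) a (n + 1)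
    have hz := capCup_zigzag (d := d) a n
    have hE := capCup_comp (d := d) a (n + 1)
    -- Expand the idempotent under the string. The first term gives `d`, the second is straightened
    -- by the zigzag relation, and `d - [n + 1] / [n + 2] = [n + 3] / [n + 2]`.
    have e : stringJW d a (n + 2) = stringsJW d a (n + 1) -
        (qint d (n + 1) / qint d (n + 2)) • (stringsJW d a (n + 1) ≫
          string a (n + 2) (capCup d (!a) n) ≫ stringsJW d a (n + 1)) := by
      rw [stringJW, jonesWenzl_add_two, string_sub, string_smul, stringsJW_eq, string_comp,
        string_comp]
    generalize string a (n + 2) (capCup d (!a) n) = F at *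
    rw [e]
    generalize stringsJW d a (n + 1) = H at *
    generalize capCup d a (n + 1) = E at *
    have h1 : E ≫ H ≫ E = d • (E ≫ H) := by rw [← hc, reassoc_of% hE, Linear.smul_comp]
    have h2 : E ≫ H ≫ F ≫ H ≫ E = E ≫ H := by
      rw [reassoc_of% hc, ← hc, reassoc_of% hz, ← reassoc_of% hc, hH]
    rw [Preadditive.sub_comp, Preadditive.comp_sub, Linear.smul_comp, Linear.comp_smul,
      Category.assoc, Category.assoc, h1, h2, ← sub_smul]
    congr 1
    rw [show n + 1 + 2 = n + 3 by rfl, show qint d (n + 3) = d * qint d (n + 2) - qint d (n + 1) by rfl]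
    field_simp

/-! ### Pairs of arcs on an alternating word -/

theorem length_alt (a : Bool) (n : ℕ) : (alt a n).length = n := by
  induction n generalizing a with
  | zero => rfl
  | succ n ih => simp [alt, ih]

/-- Upper points are counted from the right, so `x = n` is the leftmost position and gives `capCup`;
any other turn leaves the first string vertical. -/
theorem ofDiagram_turn_alt {a : Bool} {n x : ℕ} (h : Opp (alt a (n + 2)) x) :
    (∃ h', ofDiagram d (turn (alt a (n + 2)) x h) =
      string a (n + 1) (ofDiagram d (turn (alt (!a) (n + 1)) x h'))) ∨
    ofDiagram d (turn (alt a (n + 2)) x h) = capCup d a n := by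
  have hx := h.1
  rw [length_alt] at hx
  by_cases c : x = (alt (!!a) n).length
  · subst c
    right
    rw [capCup, ← ofDiagram_id, tensorHom_ofDiagram, arcs_tensor_id a _ h]
    rfl
  · left
    rw [length_alt] at c
    have hx' : x + 1 < (alt (!a) (n + 1)).length := by rw [length_alt]; omega
    refine ⟨opp_append_right (u := [a]) h hx', ?_⟩
    rw [string, ← ofDiagram_id, tensorHom_ofDiagram]
    exact congrArg (ofDiagram d) (id_tensor_turn (u := [a]) h hx').symm

theorem stringJW_turn {a : Bool} {n : ℕ} (hk : Kills (jonesWenzl d (!a) n)) (x : ℕ) (h') :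
    stringJW d a n ≫ string a n (ofDiagram d (turn (alt (!a) n) x h')) = 0 ∧
    string a n (ofDiagram d (turn (alt (!a) n) x h')) ≫ stringJW d a n = 0 := by
  rw [stringJW, string_comp, string_comp, hk.right, hk.left, string_zero]
  exact ⟨rfl, rfl⟩

theorem not_opp_of_length_le_one {w : List Bool} (hw : w.length ≤ 1) {x : ℕ} (h : Opp w x) :
    False := by
  have := h.1
  omega

/-- The coefficient of the pair of arcs in a product. -/
theorem arcs_factor {a : Bool} {v : List Bool} (h : Opp (a :: (!a) :: v) v.length)
    {D D' : Diagram ((!a) :: v) ((!a) :: v)}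
    (e : ((Diagram.id [a]).tensor D).comp ((turn _ _ h).comp ((Diagram.id [a]).tensor D')) =
      turn (a :: (!a) :: v) v.length h) : D = Diagram.id _ ∧ D' = Diagram.id _ := by
  have hN : v.length + 1 < v.length + 1 + 1 := by omega
  -- An upper arc of `D` would persist in the product, but to the right of the first string, whereas
  -- the only upper arc of the turn involves that string. Lower arcs of `D'` are excluded in the
  -- same way.
  rcases D.eq_id_or_top with ⟨x, hx, hD⟩ | rfl
  · exfalso
    simp only [List.length_cons] at hx
    have e1 : ((Diagram.id [a]).tensor D).partner x = x + 1 := by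
      simp only [Diagram.tensor, ins, List.length_cons, shift, hD]
      rw [if_pos (by omega), if_pos (by omega)]
    have := Diagram.comp_top ((Diagram.id [a]).tensor D)
      ((turn _ _ h).comp ((Diagram.id [a]).tensor D')) (x := x) (by simp; omega) (by simp; omega)
    rw [e1] at this
    have e2 := congrFun (congrArg partner e) x
    have e3 := e2.symm.trans this
    have := turnp_cases hN x
    simp only [turn, List.length_cons] at e3
    omega
  refine ⟨rfl, ?_⟩
  have e0 : (turn _ _ h).comp ((Diagram.id [a]).tensor D') = turn (a :: (!a) :: v) v.length h := by
    rw [id_tensor_id] at e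
    exact (Diagram.id_comp _).1.symm.trans e
  rcases D'.eq_id_or_bot with ⟨x, hx, hD⟩ | h
  · exfalso
    simp only [List.length_cons] at hx hD
    have e1 : ((Diagram.id [a]).tensor D').partner (v.length + 1 + 1 + (v.length - x)) =
        v.length + 1 + 1 + (v.length - x) + 1 := by
      have := ins_shift (t := v.length + 1) (l := 1 + 1) (Diagram.id [a]).partner D'.partner
        (v.length + 1 + (v.length + 1 - 2 - x))
      rw [hD] at this
      simp only [shift] at this
      rw [if_neg (by omega), if_neg (by omega), show v.length + 1 + (v.length + 1 - 2 - x) + (1 + 1) =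
        v.length + 1 + 1 + (v.length - x) by omega] at this
      refine this.trans ?_
      omega
    have := Diagram.comp_bot (turn _ _ h) ((Diagram.id [a]).tensor D') (x := v.length - x)
    simp only [List.cons_append, List.nil_append, List.length_cons] at this
    have e3 := (congrFun (congrArg partner e0) _).symm.trans (this (by rw [e1]; omega))
    rw [e1] at e3
    have := turnp_cases hN (v.length + 1 + 1 + (v.length - x))
    simp only [turn, List.length_cons] at e3
    omega
  · exact h

theorem opp_arcs (a : Bool) (v : List Bool) : Opp (a :: (!a) :: v) v.length := by
  refine ⟨by simp, ?_⟩
  simp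

/-- By `arcs_factor` only the identity terms of `f` and `g` contribute. This shows that the element
used in `qint_ne_zero` is nonzero. -/
theorem coeff_arcs (a : Bool) (n : ℕ) (f g : (⟨alt (!a) (n + 1)⟩ : KCat d) ⟶ ⟨alt (!a) (n + 1)⟩) :
    coeff (turn (alt a (n + 2)) _ (opp_arcs a (alt (!!a) n)))
      (string a (n + 1) f ≫ capCup d a n ≫ string a (n + 1) g) =
      coeff (Diagram.id _) f * coeff (Diagram.id _) g := by
  have e : capCup d a n = ofDiagram d (turn (alt a (n + 2)) _ (opp_arcs a (alt (!!a) n))) := by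
    rw [capCup, ← ofDiagram_id, tensorHom_ofDiagram, arcs_tensor_id a _ (opp_arcs a _)]
    rfl
  rw [e]
  induction f using hom_induction with
  | zero => rw [string_zero, Limits.zero_comp, coeff_zero, coeff_zero, zero_mul]
  | add f₁ f₂ h₁ h₂ => rw [string_add, Preadditive.add_comp, coeff_add, coeff_add, h₁, h₂, add_mul]
  | smul b D =>
  induction g using hom_induction with
  | zero => rw [string_zero, Limits.comp_zero, Limits.comp_zero, coeff_zero, coeff_zero, mul_zero]
  | add f₁ f₂ h₁ h₂ =>
    rw [string_add, Preadditive.comp_add, Preadditive.comp_add, coeff_add, coeff_add, h₁, h₂,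
      mul_add]
  | smul b' D' =>
    simp only [string_smul, Linear.smul_comp, Linear.comp_smul, coeff_smul, coeff_ofDiagram]
    set T := turn (alt a (n + 2)) _ (opp_arcs a (alt (!!a) n)) with hT
    by_cases h : D = Diagram.id _ ∧ D' = Diagram.id _
    · obtain ⟨rfl, rfl⟩ := h
      rw [ofDiagram_id, string_id, Category.comp_id, Category.id_comp, coeff_ofDiagram, if_pos rfl,
        if_pos rfl]
      ring
    · have h0 : (stringDiagram a (n + 1) D).comp (T.comp (stringDiagram a (n + 1) D')) ≠ T :=
        fun h' => h (arcs_factor (opp_arcs a (alt (!!a) n)) h')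
      rw [string_ofDiagram, string_ofDiagram, ofDiagram_comp, Linear.comp_smul, ofDiagram_comp,
        coeff_smul, coeff_smul, coeff_ofDiagram,
        if_neg h0]
      split_ifs with h1 h2
      · exact absurd ⟨h1, h2⟩ h
      all_goals simp

/-! ### Semisimplicity and the induction on the number of strings -/

/-- The left ideal of `x` is generated by an idempotent `e = s * x`, so `x = x * e = x * (s * x) =
0`. -/
theorem _root_.IsSemisimpleRing.eq_zero_of_mul_mul {R : Type*} [Ring R] [IsSemisimpleRing R] {x : R}
    (h : ∀ r, x * (r * x) = 0) : x = 0 := by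
  obtain ⟨e, he, hx⟩ := IsSemisimpleRing.ideal_eq_span_idempotent (Ideal.span {x})
  obtain ⟨r, hr⟩ := Ideal.mem_span_singleton'.1 (hx ▸ Ideal.mem_span_singleton_self x)
  obtain ⟨s, hs⟩ := Ideal.mem_span_singleton'.1 (hx.symm ▸ Ideal.mem_span_singleton_self e)
  calc x = x * e := by rw [← hr, mul_assoc, he.eq]
    _ = 0 := by rw [← hs, h]

/-- The main properties of the Jones-Wenzl idempotent on `n` strings. -/
structure IsJonesWenzl (d : ℂ) (n : ℕ) : Prop where
  idem : ∀ a, jonesWenzl d a n ≫ jonesWenzl d a n = jonesWenzl d a n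
  kills : ∀ a, Kills (jonesWenzl d a n)
  coeff : ∀ a, coeff (Diagram.id _) (jonesWenzl d a n) = 1

theorem isJonesWenzl_of_le_one {n : ℕ} (hn : n ≤ 1) : IsJonesWenzl d n := by
  have e : ∀ a, jonesWenzl d a n = 𝟙 _ := by
    intro a
    interval_cases n <;> rfl
  refine ⟨fun a => ?_, fun a => ⟨fun x h => ?_, fun x h => ?_⟩, fun a => ?_⟩
  · rw [e, Category.comp_id]
  · exact (not_opp_of_length_le_one ((length_alt a n).trans_le hn) h).elim
  · exact (not_opp_of_length_le_one ((length_alt a n).trans_le hn) h).elim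
  · rw [e, coeff_id_id]

theorem coeff_stringJW {n : ℕ} (h : IsJonesWenzl d n) (a : Bool) :
    coeff (Diagram.id _) (stringJW d a n) = 1 := by
  refine (coeff_id_tensor _ _).trans ?_
  rw [coeff_id_id, h.coeff, one_mul]

/-- The leftmost pair of arcs is killed by `wenzl_step`, all others by the smaller idempotent beside
the string. The correction term does not change the coefficient of the identity, because it contains
`capCup`. -/
theorem isJonesWenzl_add_two {n : ℕ} (h : IsJonesWenzl d n) (h' : IsJonesWenzl d (n + 1))
    (hq : qint d (n + 1) ≠ 0) (hq' : qint d (n + 2) ≠ 0) : IsJonesWenzl d (n + 2) := by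
  have key := fun a => wenzl_step (stringJW_idem (h'.idem (!a)))
    (capCup_string_capCup a h.idem hq) (capCup_comp_stringsJW a n) (strings_absorb (h.idem _)).1
    (strings_absorb (h.idem _)).2 (c := qint d (n + 1) / qint d (n + 2)) (by field_simp)
  simp only [← jonesWenzl_add_two] at key
  refine ⟨fun a => (key a).1, fun a => ⟨fun x hx => ?_, fun x hx => ?_⟩, fun a => ?_⟩
  · rcases ofDiagram_turn_alt (d := d) hx with ⟨hx', e⟩ | e
    · rw [e, jonesWenzl_add_two, Preadditive.sub_comp, Linear.smul_comp, Category.assoc,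
        Category.assoc, (stringJW_turn (h'.kills (!a)) x hx').1]
      simp
    · rw [e, (key a).2.2]
  · rcases ofDiagram_turn_alt (d := d) hx with ⟨hx', e⟩ | e
    · have := (stringJW_turn (h'.kills (!a)) x hx').2
      rw [e, jonesWenzl_add_two, Preadditive.comp_sub, Linear.comp_smul, reassoc_of% this, this]
      simp
    · rw [e, (key a).2.1]
  · rw [jonesWenzl_add_two, coeff_sub, coeff_smul, coeff_id_comp, coeff_id_comp,
      coeff_stringJW h']
    have : coeff (Diagram.id _) (capCup d a n) = 0 := by
      refine (coeff_id_tensor _ _).trans ?_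
      rw [coeff_ofDiagram, if_neg, zero_mul]
      intro e
      have := congrFun (congrArg partner e) 0
      exact absurd this (by cases a <;> decide)
    rw [this]
    simp

/-- If `[n + 2]` vanishes, the endomorphism algebra is not semisimple. -/
theorem qint_ne_zero (hd : d ≠ 0) (hss : ∀ n : ℕ, IsSemisimpleRing (End (⟨alt true n⟩ : KCat d)))
    {n : ℕ} (h : IsJonesWenzl d n) (h' : IsJonesWenzl d (n + 1)) (hq : qint d (n + 1) ≠ 0) :
    qint d (n + 2) ≠ 0 := by
  intro hq'
  have he := capCup_string_capCup true h.idem hq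
  rw [hq', zero_div, zero_smul] at he
  obtain ⟨x, hx⟩ : ∃ x, stringJW d true (n + 1) ≫ capCup d true n ≫ stringJW d true (n + 1) = x :=
    ⟨_, rfl⟩
  have hg := stringJW_idem (h'.idem (!true))
  -- For a diagram with an upper arc, already `x` followed by the corresponding turn vanishes: by
  -- the killing property, or by `he` if the turn is `capCup`. For the identity, `x ≫ x` contains
  -- the factor of `he`.
  have key : ∀ f, x ≫ f ≫ x = 0 := by
    intro f
    induction f using hom_induction with
    | zero => simp
    | add f g hf hg => rw [Preadditive.add_comp, Preadditive.comp_add, hf, hg, add_zero]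
    | smul c D =>
      rw [Linear.smul_comp, Linear.comp_smul]
      suffices x ≫ ofDiagram d D ≫ x = 0 by rw [this, smul_zero]
      rcases D.eq_id_or_top with ⟨y, hy, hD⟩ | rfl
      · obtain ⟨c', ho, e⟩ := ofDiagram_top hd D hy hD
        rw [e, Linear.smul_comp, Linear.comp_smul]
        rcases ofDiagram_turn_alt (d := d) ho with ⟨hx', e⟩ | e
        · have := (stringJW_turn (h'.kills (!true)) y hx').1
          rw [e, ← hx, Category.assoc, Category.assoc, Category.assoc, reassoc_of% this]
          simp
        · rw [e, ← hx]
          simp only [Category.assoc]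
          rw [reassoc_of% he]
          simp
      · rw [ofDiagram_id, Category.id_comp, ← hx]
        simp only [Category.assoc]
        rw [reassoc_of% hg, reassoc_of% he]
        simp
  have hx0 : x = 0 := by
    have := hss (n + 2)
    refine IsSemisimpleRing.eq_zero_of_mul_mul (R := End (⟨alt true (n + 2)⟩ : KCat d)) fun f => ?_
    rw [End.mul_def, End.mul_def, ← key f, Category.assoc]
  -- The pair of arcs has coefficient `1 * 1` in `x`, which contradicts `x = 0`.
  have := coeff_arcs true n (jonesWenzl d (!true) (n + 1)) (jonesWenzl d (!true) (n + 1))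
  rw [h'.coeff, ← stringJW, hx, hx0, coeff_zero] at this
  simp at this

/-- The recursion reaches back two steps, so two consecutive cases are carried along. Quantum
integers do not depend on the first letter, so semisimplicity for words starting with X also serves
those starting with X*. -/
theorem isJonesWenzl (hd : d ≠ 0)
    (hss : ∀ n : ℕ, IsSemisimpleRing (End (⟨alt true n⟩ : KCat d))) (n : ℕ) :
    (IsJonesWenzl d n ∧ IsJonesWenzl d (n + 1)) ∧ qint d (n + 1) ≠ 0 := by
  induction n with
  | zero =>
    exact ⟨⟨isJonesWenzl_of_le_one (by omega), isJonesWenzl_of_le_one (by omega)⟩, one_ne_zero⟩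
  | succ n ih =>
    obtain ⟨⟨h, h'⟩, hq⟩ := ih
    have hq' := qint_ne_zero hd hss h h' hq
    exact ⟨⟨h', isJonesWenzl_add_two h h' hq hq'⟩, hq'⟩

/-! ### The idempotents `P_w` -/

/-- Factors are nonempty, and each of them ends with the first letter of the next one. -/
def IsMaximal : List (Bool × ℕ) → Prop
  | [] => True
  | (a, n) :: l => 0 < n ∧
      (∀ b, (partsWord l).head? = some b → (alt a n).getLast? = some b) ∧ IsMaximal l

/-- A letter absorbed into the first factor leaves its last letter unchanged. A new factor is opened
only if the next letter is not opposite, hence equal. -/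
theorem isMaximal_parts (w : List Bool) : IsMaximal (parts w) := by
  induction w with
  | nil => trivial
  | cons a w ih =>
    rw [parts]
    split
    · exact ⟨one_pos, by simp [partsWord], trivial⟩
    · next b n l h =>
      rw [h] at ih
      obtain ⟨hn, hb, hl⟩ := ih
      obtain ⟨n, rfl⟩ := Nat.exists_eq_add_one.2 hn
      split_ifs with e
      · subst e
        refine ⟨Nat.succ_pos _, fun b hb' => ?_, hl⟩
        have := hb b hb'
        rw [alt] at this ⊢
        rw [alt, List.getLast?_cons_cons]
        exact this
      · refine ⟨one_pos, fun c hc => ?_, hn, hb, hl⟩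
        simp only [partsWord, alt, List.cons_append, List.head?_cons, Option.some.injEq] at hc
        simp only [alt, List.getLast?_singleton, Option.some.injEq]
        rw [← hc]
        cases a <;> cases b <;> simp_all

variable {d : ℂ}

theorem partsProj_idem (h : ∀ n, IsJonesWenzl d n) (l : List (Bool × ℕ)) :
    partsProj d l ≫ partsProj d l = partsProj d l := by
  induction l with
  | nil => exact Category.comp_id _
  | cons p l ih =>
    obtain ⟨a, n⟩ := p
    refine (tensorHom_comp _ _ _ _).trans ?_
    rw [(h n).idem, ih]
    rfl

theorem partsProj_coeff (h : ∀ n, IsJonesWenzl d n) (l : List (Bool × ℕ)) :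
    coeff (Diagram.id _) (partsProj d l) = 1 := by
  induction l with
  | nil => exact coeff_id_id _
  | cons p l ih =>
    obtain ⟨a, n⟩ := p
    refine (coeff_id_tensor _ _).trans ?_
    rw [(h n).coeff, ih, one_mul]

/-- Maximality of the alternating factors supplies the border condition of `Kills.tensor`. -/
theorem partsProj_kills (h : ∀ n, IsJonesWenzl d n) (l : List (Bool × ℕ)) (hl : IsMaximal l) :
    Kills (partsProj d l) := by
  induction l with
  | nil =>
    exact ⟨fun x hx => (not_opp_of_length_le_one (Nat.zero_le _) hx).elim,
      fun x hx => (not_opp_of_length_le_one (Nat.zero_le _) hx).elim⟩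
  | cons p l ih =>
    obtain ⟨a, n⟩ := p
    exact ((h n).kills a).tensor (ih hl.2.2) hl.2.1

end

end OrientedKauffman

theorem corollary3p3 (d : ℂ) (hd : d ≠ 0)
    (hss : ∀ n : ℕ, IsSemisimpleRing (End (⟨alt true n⟩ : KCat d))) :
    ∃ hP : ∀ w : List Bool, proj d w ≫ proj d w = proj d w,
      (∀ w w' : List Bool, w ≠ w' →
        ∀ f : simpleObj d w (hP w) ⟶ simpleObj d w' (hP w'), f = 0) ∧
      (∀ (w : List Bool) (f : simpleObj d w (hP w) ⟶ simpleObj d w (hP w)),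
        ∃! c : ℂ, f = c • 𝟙 (simpleObj d w (hP w))) := by
  have h : ∀ n, IsJonesWenzl d n := fun n => (isJonesWenzl hd hss n).1.1
  have hP : ∀ w : List Bool, proj d w ≫ proj d w = proj d w := fun w => partsProj_idem h _
  have hk : ∀ w, Kills (proj d w) := fun w => partsProj_kills h _ (isMaximal_parts w)
  have h0 : ∀ w, proj d w ≠ 0 := fun w e => by
    have := partsProj_coeff h (parts w)
    rw [← proj, e, coeff_zero] at this
    exact zero_ne_one this
  refine ⟨hP, fun w w' hw f => ?_, fun w f => ?_⟩
  · apply Idempotents.Karoubi.hom_ext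
    -- In the idempotent completion a morphism equals its compression by the two idempotents.
    refine f.comm.symm.trans ((hk w).sandwich_of_ne hd (hk w') (fun e => hw ?_) f.f)
    rw [← partsWord_parts w, ← partsWord_parts w', e]
  · obtain ⟨c, hc⟩ := (hk w).sandwich_self hd (hk w) f.f
    rw [hP] at hc
    refine ⟨c, Idempotents.Karoubi.hom_ext _ _ (f.comm.symm.trans hc), fun c' hc' => ?_⟩
    have e : f.f = c' • proj d w := congrArg Idempotents.Karoubi.Hom.f hc'
    have := e.symm.trans (f.comm.symm.trans hc)
    -- Uniqueness of the scalar is the nonvanishing of `proj d w`, that is, of the identity of the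
    -- object.
    exact smul_left_injective ℂ (h0 w) this
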